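/- Let $\Lambda = 2\omega_1\mathbb Z + 2\omega_2\mathbb Z \subset \mathbb C$ be a lattice, let $\sigma$ be its Weierstrass function $\sigma(u)=u\prod_{s\in\Lambda\setminus\{0\}}(1-\tfrac us)\,e^{u/s+u^2/(2s^2)}$ and $\zeta=\sigma'/\sigma$. Let $\eta\in\mathbb C\setminus\Lambda$, and let $(x,p)\in\mathbb C^N\times\mathbb C^N$ be a point of the phase space of the $N$-particle elliptic Ruijsenaars–Schneider model with $x_i-x_j\notin\Lambda$ and $x_i-x_j-\eta\notin\Lambda$ for all $i\neq j$. Put $$H_1=\sum_i e^{p_i}\prod_{j\ne i}\frac{\sigma(x_i-x_j+\eta)}{\sigma(x_i-x_j)},\qquad \bar H_1=\sigma^2(\eta)\sum_i e^{-p_i}\prod_{j\ne i}\frac{\sigma(x_i-x_j-\eta)}{\sigma(x_i-x_j)},$$ $\dot x_i=\partial H_1/\partial p_i$, $\mathring x_i=\partial\bar H_1/\partial p_i$, and let $$L_{ij}(\lambda)=e^{-(x_i-x_j)\zeta(\lambda)}\,\dot x_i\,\frac{\sigma(x_i-x_j-\eta+\lambda)}{\sigma(\lambda)\,\sigma(x_i-x_j-\eta)}$$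 be the Lax matrix. Let $\tilde\Gamma\subset\mathbb P^1\times\mathbb C$ be the closure of the set of points $(z,\lambda)$ with $z\in\mathbb C$, $\lambda\notin\Lambda$, $\det(zI-L(\lambda))=0$, and let the spectral curve $\Gamma$ be the factor of $\tilde\Gamma$ over the group generated by the two transformations $(z,\lambda)\mapsto(e^{-2\zeta(\omega_\alpha)\eta}z,\ \lambda+2\omega_\alpha)$, $\alpha=1,2$. Suppose that $(x,p)$ is a turning point, i.e. $\dot x_i+\mathring x_i=0$ for all $i$. Then $(z,\lambda)\mapsto(z^{-1},N\eta-\lambda)$ (with $0^{-1}=\infty$, $\infty^{-1}=0$) maps $\tilde\Gamma$ to itself and induces a well-defined holomorphic involution $\iota:\Gamma\to\Gamma$. (Here a self-map of $\Gamma$ is called holomorphic if near every point of $\tilde\Gamma$ it is induced by a holomorphic map of $\mathbb P^1\times\mathbb C$.) Moreover, for all $\lambda$ with $\lambda\notin\Lambda$ and $N\eta-\lambda\notin\Lambda$ the matrix $L(\lambda)$ is invertible and $$(L^T(\lambda))^{-1}=U\,L(N\eta-\lambda)\,U^{-1},$$ where $U=\mathrm{diag}(U_1,\dots,U_N)$ is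 the invertible diagonal matrix with $$U_i=e^{x_i(\zeta(\lambda)+\zeta(N\eta-\lambda))}\prod_{k\ne i}\frac{\sigma(x_i-x_k)}{\sigma(x_i-x_k+\eta)}.$$ -/

import Mathlib

open Set Filter Topology
open scoped Manifold ContDiff

noncomputable section

/-! ### Weierstrass functions of a period lattice

`L : PeriodPair` consists of the two full periods `L.ω₁ = 2ω_1`, `L.ω₂ = 2ω_2`. -/

namespace PeriodPair

/-- Weierstrass sigma function,
`σ(u) = u ∏_{s ≠ 0} (1 - u / s) exp (u / s + u² / (2 s²))`, `s` running over the lattice. -/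
def sigma (L : PeriodPair) (u : ℂ) : ℂ :=
  u * ∏' s : {s : ℂ // s ∈ L.lattice ∧ s ≠ 0},
    (1 - u / s.1) * Complex.exp (u / s.1 + u ^ 2 / (2 * s.1 ^ 2))

/-- Weierstrass zeta function `ζ = σ' / σ`. -/
def zeta (L : PeriodPair) (u : ℂ) : ℂ := deriv L.sigma u / L.sigma u

end PeriodPair

/-! ### The Riemann sphere -/

namespace RiemannSphere

/-- The map `z ↦ z⁻¹` of the Riemann sphere `OnePoint ℂ`, with `0 ↦ ∞` and `∞ ↦ 0`. -/
def inv : OnePoint ℂ → OnePoint ℂ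
  | none => ((0 : ℂ) : OnePoint ℂ)
  | some z => if z = 0 then OnePoint.infty else ((z⁻¹ : ℂ) : OnePoint ℂ)

lemma inv_infty : inv OnePoint.infty = ((0 : ℂ) : OnePoint ℂ) := rfl

lemma inv_zero : inv ((0 : ℂ) : OnePoint ℂ) = OnePoint.infty := if_pos rfl

lemma inv_coe {z : ℂ} (hz : z ≠ 0) : inv (z : OnePoint ℂ) = ((z⁻¹ : ℂ) : OnePoint ℂ) :=
  if_neg hz

lemma inv_inv (w : OnePoint ℂ) : inv (inv w) = w := by
  induction w using OnePoint.rec with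
  | infty => rw [inv_infty, inv_zero]
  | coe z =>
    by_cases hz : z = 0
    · subst hz; rw [inv_zero, inv_infty]
    · rw [inv_coe hz, inv_coe (inv_ne_zero hz), _root_.inv_inv]

lemma continuous_inv : Continuous inv := by
  rw [OnePoint.continuous_iff]
  constructor
  · rw [inv_infty, Filter.coclosedCompact_eq_cocompact]
    have h1 : Tendsto (fun z : ℂ => ((z⁻¹ : ℂ) : OnePoint ℂ)) (cocompact ℂ)
        (𝓝 ((0 : ℂ) : OnePoint ℂ)) :=
      (OnePoint.continuous_coe.tendsto 0).comp (by
        rw [← Metric.cobounded_eq_cocompact]; exact tendsto_inv₀_cobounded)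
    refine h1.congr' ?_
    have : ∀ᶠ z : ℂ in cocompact ℂ, z ≠ 0 :=
      (isCompact_singleton (x := (0 : ℂ))).compl_mem_cocompact
    filter_upwards [this] with z hz
    exact (inv_coe hz).symm
  · rw [continuous_iff_continuousAt]
    intro z
    by_cases hz : z = 0
    · subst hz
      rw [continuousAt_iff_punctured_nhds, inv_zero]
      have h1 : Tendsto (fun z : ℂ => ((z⁻¹ : ℂ) : OnePoint ℂ)) (𝓝[≠] 0)
          (𝓝 OnePoint.infty) := by
        refine Tendsto.comp OnePoint.tendsto_coe_infty ?_
        rw [Filter.coclosedCompact_eq_cocompact, ← Metric.cobounded_eq_cocompact]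
        exact tendsto_inv₀_nhdsNE_zero
      refine h1.congr' ?_
      filter_upwards [self_mem_nhdsWithin] with w hw
      exact (inv_coe hw).symm
    · have h1 : ContinuousAt (fun z : ℂ => ((z⁻¹ : ℂ) : OnePoint ℂ)) z :=
        OnePoint.continuous_coe.continuousAt.comp (continuousAt_inv₀ hz)
      refine h1.congr ?_
      filter_upwards [isOpen_ne.mem_nhds hz] with w hw
      exact (inv_coe hw).symm

/-- Inversion as a homeomorphism. -/
def invHomeomorph : OnePoint ℂ ≃ₜ OnePoint ℂ where
  toFun := inv
  invFun := inv
  left_inv := inv_inv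
  right_inv := inv_inv
  continuous_toFun := continuous_inv
  continuous_invFun := continuous_inv

/-- The affine chart `z` on `ℂ ⊂ OnePoint ℂ`. -/
def chartZero : OpenPartialHomeomorph (OnePoint ℂ) ℂ :=
  (OnePoint.isOpenEmbedding_coe (X := ℂ)).toOpenPartialHomeomorph.symm

/-- The chart `1 / z` on the complement of `0`. -/
def chartInfty : OpenPartialHomeomorph (OnePoint ℂ) ℂ :=
  invHomeomorph.toOpenPartialHomeomorph.trans chartZero

lemma chartZero_source : chartZero.source = range ((↑) : ℂ → OnePoint ℂ) := by
  simp [chartZero]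

lemma chartZero_coe (z : ℂ) : chartZero (z : OnePoint ℂ) = z :=
  (OnePoint.isOpenEmbedding_coe (X := ℂ)).toOpenPartialHomeomorph.left_inv (by simp)

lemma chartZero_symm (z : ℂ) : chartZero.symm z = (z : OnePoint ℂ) := rfl

/-- The complex structure of the Riemann sphere: the charts `z` and `1 / z`. -/
instance : ChartedSpace ℂ (OnePoint ℂ) where
  atlas := {chartZero, chartInfty}
  chartAt w := w.elim chartInfty fun _ => chartZero
  mem_chart_source w := by
    induction w using OnePoint.rec with
    | infty => simp [chartInfty, chartZero_source, invHomeomorph, inv_infty]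
    | coe z => simp [chartZero_source]
  chart_mem_atlas w := by
    induction w using OnePoint.rec <;> simp

instance : IsManifold 𝓘(ℂ, ℂ) ω (OnePoint ℂ) := by
  have key : ∀ z : ℂ, inv (z : OnePoint ℂ) ∈ chartZero.source →
      z ≠ 0 ∧ chartZero (inv (z : OnePoint ℂ)) = z⁻¹ := by
    intro z hz
    have h0 : z ≠ 0 := by
      rintro rfl
      rw [inv_zero, chartZero_source] at hz
      exact OnePoint.infty_notMem_range_coe hz
    exact ⟨h0, by rw [inv_coe h0, chartZero_coe]⟩
  refine isManifold_of_contDiffOn _ _ _ ?_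
  rintro e e' (rfl | rfl) (rfl | rfl)
  · refine contDiffOn_id.congr ?_
    intro z _
    exact chartZero_coe z
  · have h : ContDiffOn ℂ ω (fun z : ℂ => z⁻¹) {z | z ≠ 0} :=
      fun z hz => (contDiffAt_inv ℂ hz).contDiffWithinAt
    refine (h.mono ?_).congr ?_
    · intro z hz
      simp [chartInfty, chartZero_symm, invHomeomorph] at hz
      exact (key z hz.2).1
    · intro z hz
      simp [chartInfty, chartZero_symm, invHomeomorph] at hz
      exact (key z hz.2).2
  · have h : ContDiffOn ℂ ω (fun z : ℂ => z⁻¹) {z | z ≠ 0} :=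
      fun z hz => (contDiffAt_inv ℂ hz).contDiffWithinAt
    refine (h.mono ?_).congr ?_
    · intro z hz
      simp [chartInfty, chartZero_symm, invHomeomorph] at hz
      exact (key z hz.2).1
    · intro z hz
      simp [chartInfty, chartZero_symm, invHomeomorph] at hz
      exact (key z hz.2).2
  · refine contDiffOn_id.congr ?_
    intro z _
    change chartZero (inv (inv (z : OnePoint ℂ))) = z
    rw [inv_inv, chartZero_coe]

end RiemannSphere

/-! ### The elliptic Ruijsenaars–Schneider model -/

namespace RuijsenaarsSchneider

variable {N : ℕ}

/-- The Hamiltonian `H₁ = ∑ᵢ e^{pᵢ} ∏_{j ≠ i} σ(xᵢ - xⱼ + η) / σ(xᵢ - xⱼ)`. -/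
def hamiltonian (L : PeriodPair) (η : ℂ) (x p : Fin N → ℂ) : ℂ :=
  ∑ i, Complex.exp (p i) *
    ∏ j ∈ Finset.univ.erase i, L.sigma (x i - x j + η) / L.sigma (x i - x j)

/-- The Hamiltonian
`H̄₁ = σ(η)² ∑ᵢ e^{-pᵢ} ∏_{j ≠ i} σ(xᵢ - xⱼ - η) / σ(xᵢ - xⱼ)`. -/
def hamiltonianBar (L : PeriodPair) (η : ℂ) (x p : Fin N → ℂ) : ℂ :=
  L.sigma η ^ 2 * ∑ i, Complex.exp (-p i) *
    ∏ j ∈ Finset.univ.erase i, L.sigma (x i - x j - η) / L.sigma (x i - x j)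

/-- The velocity `ẋᵢ = ∂H₁ / ∂pᵢ` in the time of the Hamiltonian `H₁`. -/
def velocity (L : PeriodPair) (η : ℂ) (x p : Fin N → ℂ) (i : Fin N) : ℂ :=
  deriv (fun q => hamiltonian L η x (Function.update p i q)) (p i)

/-- The velocity `x̊ᵢ = ∂H̄₁ / ∂pᵢ` in the time of the Hamiltonian `H̄₁`. -/
def velocityBar (L : PeriodPair) (η : ℂ) (x p : Fin N → ℂ) (i : Fin N) : ℂ :=
  deriv (fun q => hamiltonianBar L η x (Function.update p i q)) (p i)

lemma velocity_eq (L : PeriodPair) (η : ℂ) (x p : Fin N → ℂ) (i : Fin N) :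
    velocity L η x p i = Complex.exp (p i) *
      ∏ j ∈ Finset.univ.erase i, L.sigma (x i - x j + η) / L.sigma (x i - x j) := by
  have h : HasDerivAt (fun q => hamiltonian L η x (Function.update p i q))
      (∑ k, if k = i then Complex.exp (p i) *
        ∏ j ∈ Finset.univ.erase i, L.sigma (x i - x j + η) / L.sigma (x i - x j) else 0)
      (p i) := by
    unfold hamiltonian
    refine HasDerivAt.fun_sum fun k _ => ?_
    split_ifs with hk
    · subst hk
      simpa using (Complex.hasDerivAt_exp (p k)).mul_const _
    · simpa [Function.update_of_ne hk] using hasDerivAt_const (p i) _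
  simpa [velocity] using h.deriv

lemma velocityBar_eq (L : PeriodPair) (η : ℂ) (x p : Fin N → ℂ) (i : Fin N) :
    velocityBar L η x p i = -(L.sigma η ^ 2 * Complex.exp (-p i) *
      ∏ j ∈ Finset.univ.erase i, L.sigma (x i - x j - η) / L.sigma (x i - x j)) := by
  have h : HasDerivAt (fun q => hamiltonianBar L η x (Function.update p i q))
      (L.sigma η ^ 2 * ∑ k, if k = i then -Complex.exp (-p i) *
        ∏ j ∈ Finset.univ.erase i, L.sigma (x i - x j - η) / L.sigma (x i - x j) else 0)
      (p i) := by
    unfold hamiltonianBar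
    refine HasDerivAt.const_mul _ (HasDerivAt.fun_sum fun k _ => ?_)
    split_ifs with hk
    · subst hk
      simpa using ((hasDerivAt_neg (p k)).cexp).mul_const _
    · simpa [Function.update_of_ne hk] using hasDerivAt_const (p i) _
  have h2 := h.deriv
  simp only [Finset.sum_ite_eq', Finset.mem_univ, if_true] at h2
  rw [velocityBar, h2]
  ring

/-- A turning point of the phase space: `ẋᵢ + x̊ᵢ = 0` for every particle. -/
def IsTurningPoint (L : PeriodPair) (η : ℂ) (x p : Fin N → ℂ) : Prop :=
  ∀ i, velocity L η x p i + velocityBar L η x p i = 0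

/-- The Lax matrix with spectral parameter `lam`,
`Lᵢⱼ = e^{-(xᵢ - xⱼ) ζ(lam)} ẋᵢ σ(xᵢ - xⱼ - η + lam) / (σ(lam) σ(xᵢ - xⱼ - η))`. -/
def laxMatrix (L : PeriodPair) (η : ℂ) (x p : Fin N → ℂ) (lam : ℂ) :
    Matrix (Fin N) (Fin N) ℂ :=
  Matrix.of fun i j =>
    Complex.exp (-(x i - x j) * L.zeta lam) * velocity L η x p i *
      (L.sigma (x i - x j - η + lam) / (L.sigma lam * L.sigma (x i - x j - η)))

/-- `R(z, lam) = det (z I - L(lam))`. -/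
def charFun (L : PeriodPair) (η : ℂ) (x p : Fin N → ℂ) (z lam : ℂ) : ℂ :=
  (z • (1 : Matrix (Fin N) (Fin N) ℂ) - laxMatrix L η x p lam).det

/-- The diagonal of the matrix conjugating `L(Nη - lam)` to the inverse transpose of `L(lam)`. -/
def gaugeDiag (L : PeriodPair) (η : ℂ) (x : Fin N → ℂ) (lam : ℂ) (i : Fin N) : ℂ :=
  Complex.exp (x i * (L.zeta lam + L.zeta (N * η - lam))) *
    ∏ k ∈ Finset.univ.erase i, L.sigma (x i - x k) / L.sigma (x i - x k + η)

/-! ### The spectral curve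

Points `(z, lam)` are elements of `OnePoint ℂ × ℂ`, where `z = ∞` is allowed. -/

/-- The `N`-sheeted covering `Γ̃` of the `lam`-plane: the points `(z, lam)`, `lam` off the lattice,
with `det (z I - L(lam)) = 0`, completed over the lattice points (where the entries of `L` are
singular) by taking the closure in `ℙ¹ × ℂ`. -/
def spectralCover (L : PeriodPair) (η : ℂ) (x p : Fin N → ℂ) : Set (OnePoint ℂ × ℂ) :=
  closure {P | ∃ z lam : ℂ, P = ((z : OnePoint ℂ), lam) ∧ lam ∉ L.lattice ∧
    charFun L η x p z lam = 0}

/-- The transformation `(z, lam) ↦ (e^{-2 (m₁ ζ(ω_1) + m₂ ζ(ω_2)) η} z, lam + 2 m₁ ω_1 + 2 m₂ ω_2)`,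
a composition of powers of the two transformations `lam ↦ lam + 2ω_α`, `z ↦ e^{-2 ζ(ω_α) η} z`. -/
def shift (L : PeriodPair) (η : ℂ) (m₁ m₂ : ℤ) (P : OnePoint ℂ × ℂ) : OnePoint ℂ × ℂ :=
  (P.1.map fun z =>
      Complex.exp (-2 * (m₁ * L.zeta (L.ω₁ / 2) + m₂ * L.zeta (L.ω₂ / 2)) * η) * z,
    P.2 + m₁ * L.ω₁ + m₂ * L.ω₂)

lemma shift_zero (L : PeriodPair) (η : ℂ) (P : OnePoint ℂ × ℂ) : shift L η 0 0 P = P := by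
  obtain ⟨w, l⟩ := P
  induction w using OnePoint.rec <;> simp [shift]

lemma shift_shift (L : PeriodPair) (η : ℂ) (m₁ m₂ n₁ n₂ : ℤ) (P : OnePoint ℂ × ℂ) :
    shift L η n₁ n₂ (shift L η m₁ m₂ P) = shift L η (n₁ + m₁) (n₂ + m₂) P := by
  obtain ⟨w, l⟩ := P
  refine Prod.ext ?_ ?_
  · induction w using OnePoint.rec with
    | infty => rfl
    | coe z =>
      simp only [shift, OnePoint.map_some, OnePoint.coe_eq_coe]
      rw [← mul_assoc, ← Complex.exp_add]
      congr 2
      push_cast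
      ring
  · simp only [shift]
    push_cast
    ring

/-- Two points of `Γ̃` are identified when they differ by one of the transformations `shift`. -/
def shiftSetoid (L : PeriodPair) (η : ℂ) (x p : Fin N → ℂ) :
    Setoid (spectralCover L η x p) where
  r P Q := ∃ m₁ m₂ : ℤ, Q.1 = shift L η m₁ m₂ P.1
  iseqv :=
    { refl := fun P => ⟨0, 0, (shift_zero L η P.1).symm⟩
      symm := by
        rintro P Q ⟨m₁, m₂, h⟩
        refine ⟨-m₁, -m₂, ?_⟩
        rw [h, shift_shift, neg_add_cancel, neg_add_cancel, shift_zero]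
      trans := by
        rintro P Q S ⟨m₁, m₂, h⟩ ⟨n₁, n₂, h'⟩
        exact ⟨n₁ + m₁, n₂ + m₂, by rw [h', h, shift_shift]⟩ }

/-- The spectral curve `Γ`: the factor of `Γ̃` over the transformations `shift`. -/
def SpectralCurve (L : PeriodPair) (η : ℂ) (x p : Fin N → ℂ) : Type :=
  Quotient (shiftSetoid L η x p)

/-- The point of `Γ` with coordinates `(z, lam)`. -/
def SpectralCurve.mk {L : PeriodPair} {η : ℂ} {x p : Fin N → ℂ} (P : OnePoint ℂ × ℂ)
    (hP : P ∈ spectralCover L η x p) : SpectralCurve L η x p :=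
  Quotient.mk (shiftSetoid L η x p) ⟨P, hP⟩

/-- A self-map of `Γ` is holomorphic if near every point of `Γ̃` it is induced by a holomorphic
map of the ambient complex surface `ℙ¹ × ℂ`. -/
def SpectralCurve.IsHolomorphic {L : PeriodPair} {η : ℂ} {x p : Fin N → ℂ}
    (f : SpectralCurve L η x p → SpectralCurve L η x p) : Prop :=
  ∀ P ∈ spectralCover L η x p, ∃ F : OnePoint ℂ × ℂ → OnePoint ℂ × ℂ,
    (∀ᶠ Q in 𝓝 P, MDifferentiableAt (𝓘(ℂ, ℂ).prod 𝓘(ℂ, ℂ)) (𝓘(ℂ, ℂ).prod 𝓘(ℂ, ℂ)) F Q) ∧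
    ∀ᶠ Q in 𝓝 P, ∀ hQ : Q ∈ spectralCover L η x p,
      ∃ hF : F Q ∈ spectralCover L η x p, f (mk Q hQ) = mk (F Q) hF

end RuijsenaarsSchneider

end

/-! The heart is the matrix identity `Lᵀ(λ) U L(Nη - λ) U⁻¹ = 1`. Each entry is a sum over `j` in
which the velocity enters only as `ẋ_j²`. At a turning point `ẋ_j² = -ẋ_j x̊_j`, so `e^{p_j}` and
`e^{-p_j}` cancel and a quotient of sigma functions of the positions remains (`velocity_sq`). The
product in `U_j` removes its `+η` half.

What is left is a sum of residues at the `x_j` of a function `∏ σ(u - b) / ∏ σ(u - a)`. This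
function is elliptic exactly because `λ + (Nη - λ) = Nη` balances zeros against poles, so its
residues add up to zero (`sum_sigmaTermRatio`). Off the diagonal the `x_j` are all the poles and the
entry vanishes; on the diagonal there is one more pole, at `x_i + η`, whose residue yields `1`. The
residue theorem is obtained algebraically, from the fact that a second-order theta function with too
many zeros vanishes. This needs the quasi-periodicity and the simple zeros of `σ`, derived from its
product.

On determinants the identity says that `z` is an eigenvalue of `L(λ)` only if `z⁻¹` is one of `L(Nη
- λ)`. It fails to apply where `λ` or `Nη - λ` is a lattice point, but the spectral cover is the
closure of its part over any dense set of `λ` (`spectralCover_subset_closure`), so the closed set is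
still preserved. The inversion conjugates each shift to its inverse and hence descends to the
quotient. -/

namespace PeriodPair

/-! ### The sigma function: convergence, quasi-periodicity, simple zeros -/

/-- The primary factor `(1 - u / s) exp (u / s + u² / (2 s²))`; it equals `1` for `s = 0`. -/
noncomputable def sigmaFactor (s u : ℂ) : ℂ :=
  (1 - u / s) * Complex.exp (u / s + u ^ 2 / (2 * s ^ 2))

/-- The exponent is minus the second Taylor polynomial of `log (1 - w)`, so the product is the
exponential of a cubic remainder. -/
lemma norm_one_sub_mul_exp_sub_one_le {w : ℂ} (hw : ‖w‖ ≤ 1 / 2) :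
    ‖(1 - w) * Complex.exp (w + w ^ 2 / 2) - 1‖ ≤ 2 * ‖w‖ ^ 3 := by
  have hw1 : ‖-w‖ < 1 := by rw [norm_neg]; linarith
  have h1 := Complex.norm_log_sub_logTaylor_le 2 hw1
  have hne : 1 + -w ≠ 0 := by
    intro h
    have : w = 1 := by linear_combination -h
    rw [this] at hw
    norm_num at hw
  have h2 : (1 - w) * Complex.exp (w + w ^ 2 / 2) =
      Complex.exp (Complex.log (1 + -w) - Complex.logTaylor (2 + 1) (-w)) := by
    have : Complex.log (1 + -w) - Complex.logTaylor (2 + 1) (-w) =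
        Complex.log (1 + -w) + (w + w ^ 2 / 2) := by
      simp [Complex.logTaylor, Finset.sum_range_succ]
      ring
    rw [this, Complex.exp_add (Complex.log _), Complex.exp_log hne, sub_eq_add_neg]
  have hw0 := norm_nonneg w
  have h3 : ‖Complex.log (1 + -w) - Complex.logTaylor (2 + 1) (-w)‖ ≤ ‖w‖ ^ 3 := by
    refine h1.trans ?_
    rw [norm_neg]
    have h4 : (1 - ‖w‖)⁻¹ ≤ 2 := by
      rw [inv_le_comm₀ (by linarith) (by norm_num)]
      linarith
    have h5 : (0 : ℝ) ≤ ‖w‖ ^ 3 := by positivity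
    have h6 := mul_le_mul_of_nonneg_left h4 h5
    norm_num
    linarith
  have h4 : ‖w‖ ^ 3 ≤ 1 := pow_le_one₀ hw0 (by linarith)
  rw [h2]
  refine (Complex.norm_exp_sub_one_le (h3.trans h4)).trans ?_
  linarith

lemma norm_sigmaFactor_sub_one_le {r : ℝ} {s u : ℂ} (hu : ‖u‖ ≤ r) (hs : 2 * r ≤ ‖s‖) :
    ‖sigmaFactor s u - 1‖ ≤ 2 * r ^ 3 * ‖s‖ ^ (-3 : ℝ) := by
  have hr : 0 ≤ r := (norm_nonneg u).trans hu
  -- With `x / 0 = 0` the factor at `s = 0` is exactly `1`, so the lattice origin needs no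
  -- exclusion.
  rcases eq_or_ne s 0 with rfl | hs0
  · simp [sigmaFactor]
  have hspos : 0 < ‖s‖ := norm_pos_iff.mpr hs0
  have hw : ‖u / s‖ ≤ 1 / 2 := by
    rw [norm_div, div_le_iff₀ hspos]
    linarith
  have h := norm_one_sub_mul_exp_sub_one_le hw
  have h2 : (u / s) ^ 2 / 2 = u ^ 2 / (2 * s ^ 2) := by field_simp
  rw [h2] at h
  refine h.trans ?_
  rw [norm_div, div_pow]
  have h3 : ‖s‖ ^ (-3 : ℝ) = (‖s‖ ^ 3)⁻¹ := by
    rw [Real.rpow_neg hspos.le]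
    norm_cast
  rw [h3, mul_assoc, div_eq_mul_inv]
  gcongr

variable (L : PeriodPair)

lemma summable_lattice_norm_rpow_neg_three :
    Summable fun s : L.lattice => ‖(s : ℂ)‖ ^ (-3 : ℝ) := by
  have := ZLattice.summable_norm_rpow L.lattice (-3) (by simp; norm_num)
  simpa using! this

lemma eventually_cofinite_lattice_le_norm (r : ℝ) :
    ∀ᶠ s : L.lattice in cofinite, r ≤ ‖(s : ℂ)‖ := by
  have h := (isCompact_iff_finite.mp (isCompact_closedBall (0 : L.lattice) r))
  filter_upwards [h.compl_mem_cofinite] with s hs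
  simp only [mem_compl_iff, Metric.mem_closedBall, dist_zero_right, not_le] at hs
  exact hs.le

lemma summable_norm_sigmaFactor_sub_one (u : ℂ) :
    Summable fun s : L.lattice => ‖sigmaFactor s u - 1‖ := by
  refine Summable.of_norm_bounded_eventually
    (L.summable_lattice_norm_rpow_neg_three.mul_left (2 * ‖u‖ ^ 3)) ?_
  filter_upwards [L.eventually_cofinite_lattice_le_norm (2 * ‖u‖)] with s hs
  rw [norm_norm]
  exact norm_sigmaFactor_sub_one_le le_rfl hs

lemma multipliable_sigmaFactor (u : ℂ) :
    Multipliable fun s : L.lattice => sigmaFactor s u := by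
  simpa using multipliable_one_add_of_summable (L.summable_norm_sigmaFactor_sub_one u)

/-- The quotient `σ(u) / u`, as an entire function. -/
noncomputable def sigmaReduced (u : ℂ) : ℂ := ∏' s : L.lattice, sigmaFactor s u

lemma sigma_eq (u : ℂ) : L.sigma u = u * L.sigmaReduced u := by
  unfold sigma sigmaReduced
  congr 1
  let g : {s : ℂ // s ∈ L.lattice ∧ s ≠ 0} → L.lattice := fun s => ⟨s.1, s.2.1⟩
  have hg : Function.Injective g := fun a b h => Subtype.ext (congrArg (fun t : L.lattice => (t : ℂ)) h)
  refine hg.tprod_eq (f := fun s : L.lattice => sigmaFactor s u) ?_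
  intro s hs
  have : (s : ℂ) ≠ 0 := by
    intro h
    apply hs
    simp [sigmaFactor, h]
  exact ⟨⟨s, s.2, this⟩, rfl⟩

lemma differentiable_sigmaFactor (s : ℂ) : Differentiable ℂ (sigmaFactor s) := by
  unfold sigmaFactor
  fun_prop

lemma differentiable_sigmaReduced : Differentiable ℂ L.sigmaReduced := by
  intro u
  set r := ‖u‖ + 1
  have hu : u ∈ Metric.ball (0 : ℂ) r := by simp [r]
  have h1 : HasProdLocallyUniformlyOn (fun (s : L.lattice) v => 1 + (sigmaFactor s v - 1))
      (fun v => ∏' s : L.lattice, (1 + (sigmaFactor s v - 1))) (Metric.ball 0 r) := by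
    refine Summable.hasProdLocallyUniformlyOn_one_add Metric.isOpen_ball
      (L.summable_lattice_norm_rpow_neg_three.mul_left (2 * r ^ 3)) ?_ ?_
    · filter_upwards [L.eventually_cofinite_lattice_le_norm (2 * r)] with s hs v hv
      exact norm_sigmaFactor_sub_one_le (by simpa using (mem_ball_zero_iff.mp hv).le) hs
    · intro s
      exact ((differentiable_sigmaFactor s).continuous.sub continuous_const).continuousOn
  simp only [add_sub_cancel] at h1
  rw [hasProdLocallyUniformlyOn_iff_tendstoLocallyUniformlyOn] at h1
  refine (h1.differentiableOn (.of_forall fun t => ?_) Metric.isOpen_ball).differentiableAt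
    (Metric.isOpen_ball.mem_nhds hu)
  exact (Differentiable.fun_finsetProd (f := fun s : L.lattice => sigmaFactor s)
    fun s _ => differentiable_sigmaFactor s).differentiableOn

lemma differentiable_sigma : Differentiable ℂ L.sigma := by
  have : L.sigma = fun u => u * L.sigmaReduced u := funext L.sigma_eq
  rw [this]
  exact differentiable_id.mul L.differentiable_sigmaReduced

lemma continuous_sigma : Continuous L.sigma := L.differentiable_sigma.continuous

lemma sigmaFactor_ne_zero {s u : ℂ} (h : u ≠ s) : sigmaFactor s u ≠ 0 := by
  refine mul_ne_zero ?_ (Complex.exp_ne_zero _)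
  rcases eq_or_ne s 0 with rfl | hs
  · simp
  · rw [sub_ne_zero]
    intro h'
    exact h ((div_eq_one_iff_eq hs).mp h'.symm)

lemma sigma_ne_zero {u : ℂ} (hu : u ∉ L.lattice) : L.sigma u ≠ 0 := by
  rw [sigma_eq]
  refine mul_ne_zero (fun h => hu (h ▸ zero_mem _)) ?_
  have := tprod_one_add_ne_zero_of_summable (f := fun s : L.lattice => sigmaFactor s u - 1)
    (fun s => by
      rw [add_sub_cancel]
      exact sigmaFactor_ne_zero fun h => hu (h ▸ s.2))
    (L.summable_norm_sigmaFactor_sub_one u)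
  simpa [sigmaReduced] using this

@[simp]
lemma sigma_zero : L.sigma 0 = 0 := by simp [sigma]

lemma sigma_neg (u : ℂ) : L.sigma (-u) = -L.sigma u := by
  rw [sigma_eq, sigma_eq, neg_mul]
  congr 2
  unfold sigmaReduced
  rw [← (Equiv.neg L.lattice).tprod_eq]
  refine tprod_congr fun s => ?_
  simp [sigmaFactor, neg_div_neg_eq]

lemma deriv_sigma_zero : deriv L.sigma 0 = 1 := by
  have h : L.sigma = fun u => u * L.sigmaReduced u := funext L.sigma_eq
  have h0 : L.sigmaReduced 0 = 1 := by simp [sigmaReduced, sigmaFactor]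
  have := (hasDerivAt_id' (0 : ℂ)).fun_mul (L.differentiable_sigmaReduced 0).hasDerivAt
  rw [h]
  simpa [h0] using this.deriv

/-- The Weierstrass product over the whole lattice, with the factor `u` at `s = 0`. -/
noncomputable def sigmaTerm (s u : ℂ) : ℂ := if s = 0 then u else sigmaFactor s u

lemma hasProd_sigmaTerm (u : ℂ) : HasProd (fun s : L.lattice => sigmaTerm s u) (L.sigma u) := by
  classical
  have h := (L.multipliable_sigmaFactor u).hasProd.mul
    (hasProd_single (f := fun s : L.lattice => if s = 0 then u else 1) 0 (fun s hs => if_neg hs))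
  rw [if_pos rfl, mul_comm] at h
  rw [sigma_eq]
  refine h.congr_fun ?_
  intro s
  by_cases hs : s = 0
  · simp [sigmaTerm, hs, sigmaFactor]
  · simp [sigmaTerm, hs]

/-- The linear exponent in the quasi-periodicity of a primary factor. -/
noncomputable def sigmaExponent (w s : ℂ) : ℂ := 1 / s - 1 / (s - w) + w / s ^ 2

/-- The quadratic exponent in the quasi-periodicity of a primary factor. -/
noncomputable def sigmaSqExponent (w s : ℂ) : ℂ := 1 / (2 * s ^ 2) - 1 / (2 * (s - w) ^ 2)

/-- Both sides vanish, as functions of `u`, only at `s - w`, so their ratio is the exponential of a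
quadratic polynomial. At `s = 0` and `s = w` one of the two terms is the bare factor `u`; the
convention `1 / 0 = 0` makes the same exponents correct there. -/
lemma exists_sigmaTerm_add {w : ℂ} (hw : w ≠ 0) (s : ℂ) :
    ∃ c : ℂ, ∀ u, sigmaTerm s (u + w) =
      c * Complex.exp (sigmaExponent w s * u + sigmaSqExponent w s * u ^ 2) *
        sigmaTerm (s - w) u := by
  rcases eq_or_ne s 0 with rfl | hs
  · refine ⟨w, fun u => ?_⟩
    have : sigmaTerm (0 - w) u = (1 + u / w) * Complex.exp (-u / w + u ^ 2 / (2 * w ^ 2)) := by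
      simp [sigmaTerm, hw, sigmaFactor, div_neg, neg_div]
    rw [this, mul_assoc, mul_left_comm (Complex.exp _), ← Complex.exp_add]
    have h0 : sigmaExponent w 0 * u + sigmaSqExponent w 0 * u ^ 2 +
        (-u / w + u ^ 2 / (2 * w ^ 2)) = 0 := by
      simp [sigmaExponent, sigmaSqExponent]
      field_simp
      ring
    rw [h0]
    simp [sigmaTerm]
    field_simp
    ring
  rcases eq_or_ne s w with rfl | hsw
  · refine ⟨-1 / s * Complex.exp (3 / 2), fun u => ?_⟩
    have : sigmaTerm (s - s) u = u := by simp [sigmaTerm]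
    rw [this, mul_assoc (-1 / s), ← Complex.exp_add]
    have h0 : 3 / 2 + (sigmaExponent s s * u + sigmaSqExponent s s * u ^ 2) =
        (u + s) / s + (u + s) ^ 2 / (2 * s ^ 2) := by
      simp [sigmaExponent, sigmaSqExponent]
      field_simp
      ring
    rw [h0]
    simp [sigmaTerm, hs, sigmaFactor]
    field_simp
    ring
  · have hsw' : s - w ≠ 0 := sub_ne_zero.mpr hsw
    refine ⟨sigmaFactor s w, fun u => ?_⟩
    simp only [sigmaTerm, if_neg hs, if_neg hsw', sigmaFactor]
    have h0 : (u + w) / s + (u + w) ^ 2 / (2 * s ^ 2) =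
        (w / s + w ^ 2 / (2 * s ^ 2)) + (sigmaExponent w s * u + sigmaSqExponent w s * u ^ 2) +
        (u / (s - w) + u ^ 2 / (2 * (s - w) ^ 2)) := by
      simp only [sigmaExponent, sigmaSqExponent]
      field_simp
      ring
    have h1 : 1 - (u + w) / s = (1 - w / s) * (1 - u / (s - w)) := by
      field_simp
      ring
    rw [h0, h1, Complex.exp_add, Complex.exp_add]
    ring

lemma norm_sigmaExponent_le {w s : ℂ} (h : 2 * ‖w‖ ≤ ‖s‖) :
    ‖sigmaExponent w s‖ ≤ 2 * ‖w‖ ^ 2 * ‖s‖ ^ (-3 : ℝ) := by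
  rcases eq_or_ne s 0 with rfl | hs
  · have : w = 0 := norm_le_zero_iff.mp (by rw [norm_zero] at h; linarith)
    simp [sigmaExponent, this]
  have hspos : 0 < ‖s‖ := norm_pos_iff.mpr hs
  have hsw : ‖s‖ / 2 ≤ ‖s - w‖ := by
    have := norm_sub_norm_le s w
    linarith
  have hsw0 : s - w ≠ 0 := norm_pos_iff.mp (by linarith)
  -- The first- and second-order terms in `1 / s` cancel, leaving the cubic decay that is summable
  -- over the lattice.
  have h1 : sigmaExponent w s = -(w ^ 2 / (s ^ 2 * (s - w))) := by
    unfold sigmaExponent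
    field_simp
    ring
  have h3 : ‖s‖ ^ (-3 : ℝ) = (‖s‖ ^ 3)⁻¹ := by
    rw [Real.rpow_neg hspos.le]
    norm_cast
  rw [h1, norm_neg, norm_div, norm_mul, norm_pow, norm_pow, h3]
  calc ‖w‖ ^ 2 / (‖s‖ ^ 2 * ‖s - w‖) ≤ ‖w‖ ^ 2 / (‖s‖ ^ 2 * (‖s‖ / 2)) := by gcongr
    _ = 2 * ‖w‖ ^ 2 * (‖s‖ ^ 3)⁻¹ := by field_simp

lemma summable_sigmaExponent (w : ℂ) : Summable fun s : L.lattice => sigmaExponent w s := by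
  refine Summable.of_norm_bounded_eventually
    (L.summable_lattice_norm_rpow_neg_three.mul_left (2 * ‖w‖ ^ 2)) ?_
  filter_upwards [L.eventually_cofinite_lattice_le_norm (2 * ‖w‖)] with s hs
  exact norm_sigmaExponent_le hs

/-- Up to the factor `-1 / 2` these are the terms of the series for `℘(w)`. -/
lemma summable_sigmaSqExponent (w : ℂ) : Summable fun s : L.lattice => sigmaSqExponent w s := by
  have h := ((L.hasSum_weierstrassP w).summable.mul_left (-1 / 2))
  refine h.congr fun s => ?_
  unfold sigmaSqExponent
  rw [show (w - (s : ℂ)) ^ 2 = ((s : ℂ) - w) ^ 2 by ring]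
  simp only [one_div, mul_inv]
  ring

/-- The reflection `s ↦ w - s` of the lattice negates each term. The quadratic part of the
multiplier of `σ` therefore disappears. -/
lemma hasSum_sigmaSqExponent (w : L.lattice) :
    HasSum (fun s : L.lattice => sigmaSqExponent w s) 0 := by
  have h := (L.summable_sigmaSqExponent w).hasSum
  have h1 : ∑' s : L.lattice, sigmaSqExponent w s = -∑' s : L.lattice, sigmaSqExponent w s := by
    conv_lhs => rw [← (Equiv.subLeft w).tsum_eq]
    rw [← tsum_neg]
    refine tsum_congr fun s => ?_
    simp only [sigmaSqExponent, Equiv.subLeft_apply, Submodule.coe_sub]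
    rw [show ((w : ℂ) - s - w) ^ 2 = (s : ℂ) ^ 2 by ring,
      show ((w : ℂ) - s) ^ 2 = ((s : ℂ) - w) ^ 2 by ring]
    ring
  have h2 : ∑' s : L.lattice, sigmaSqExponent w s = 0 := by linear_combination h1 / 2
  rwa [h2] at h

/-- Quasi-periodicity of the Weierstrass sigma function. -/
lemma exists_sigma_add {w : ℂ} (hw : w ∈ L.lattice) :
    ∃ A C : ℂ, C ≠ 0 ∧ ∀ u, L.sigma (u + w) = C * Complex.exp (A * u) * L.sigma u := by
  rcases eq_or_ne w 0 with rfl | hw0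
  · exact ⟨0, 1, one_ne_zero, by simp⟩
  choose c hc using exists_sigmaTerm_add hw0
  have hshift (u : ℂ) :
      HasProd (fun s : L.lattice => sigmaTerm (s - w) u) (L.sigma u) := by
    have := (Equiv.subRight (⟨w, hw⟩ : L.lattice)).hasProd_iff.mpr (L.hasProd_sigmaTerm u)
    simpa [Function.comp_def] using! this
  set A := ∑' s : L.lattice, sigmaExponent w s
  have hexp (u : ℂ) : HasProd (fun s : L.lattice =>
      Complex.exp (sigmaExponent w s * u + sigmaSqExponent w s * u ^ 2)) (Complex.exp (A * u)) := by
    have h := ((L.summable_sigmaExponent w).hasSum.mul_right u).add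
      ((L.hasSum_sigmaSqExponent ⟨w, hw⟩).mul_right (u ^ 2))
    rw [zero_mul, add_zero] at h
    exact h.cexp
  -- The product of the constants `c s` converges because, at a point where no factor vanishes, it
  -- is a quotient of convergent products with nonzero limits.
  set u₀ := L.ω₁ / 2
  have hu₀ : L.sigma u₀ ≠ 0 := L.sigma_ne_zero L.ω₁_div_two_notMem_lattice
  have hu₁ : L.sigma (u₀ + w) ≠ 0 := L.sigma_ne_zero fun h =>
    L.ω₁_div_two_notMem_lattice (by simpa [u₀] using sub_mem h hw)
  have hcprod : HasProd (fun s : L.lattice => c s)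
      (L.sigma (u₀ + w) * (Complex.exp (A * u₀))⁻¹ * (L.sigma u₀)⁻¹) := by
    have h := ((L.hasProd_sigmaTerm (u₀ + w)).mul ((hexp u₀).inv₀ (Complex.exp_ne_zero _))).mul
      ((hshift u₀).inv₀ hu₀)
    refine h.congr_fun fun s => ?_
    have hne : sigmaTerm (s - w) u₀ ≠ 0 := by
      unfold sigmaTerm
      split_ifs with h0
      · intro h
        exact hu₀ (by simp [h])
      · exact sigmaFactor_ne_zero fun h =>
          L.ω₁_div_two_notMem_lattice (show u₀ ∈ L.lattice from h ▸ sub_mem s.2 hw)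
    rw [hc]
    field_simp [Complex.exp_ne_zero]
  refine ⟨A, L.sigma (u₀ + w) * (Complex.exp (A * u₀))⁻¹ * (L.sigma u₀)⁻¹, ?_, fun u => ?_⟩
  rotate_left
  · refine (L.hasProd_sigmaTerm (u + w)).unique ?_
    exact ((hcprod.mul (hexp u)).mul (hshift u)).congr_fun fun s => hc s u
  · exact mul_ne_zero (mul_ne_zero hu₁ (inv_ne_zero (Complex.exp_ne_zero _))) (inv_ne_zero hu₀)

lemma sigma_eq_zero_iff {u : ℂ} : L.sigma u = 0 ↔ u ∈ L.lattice := by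
  refine ⟨fun h => by_contra fun h' => L.sigma_ne_zero h' h, fun h => ?_⟩
  obtain ⟨A, C, -, hAC⟩ := L.exists_sigma_add h
  simpa using hAC 0

/-- Quasi-periodicity carries the simple zero at the origin to every lattice point. -/
lemma deriv_sigma_ne_zero {u : ℂ} (hu : u ∈ L.lattice) : deriv L.sigma u ≠ 0 := by
  obtain ⟨A, C, hC, hAC⟩ := L.exists_sigma_add hu
  have h1 : HasDerivAt (fun v => L.sigma (v + u)) (deriv L.sigma u) 0 := by
    have h := (L.differentiable_sigma (0 + u)).hasDerivAt
    rw [zero_add] at h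
    exact HasDerivAt.comp_add_const 0 u (by simpa using h)
  have h2 : HasDerivAt (fun v => L.sigma (v + u)) C 0 := by
    simp_rw [hAC]
    have h := (((hasDerivAt_id' (0 : ℂ)).const_mul A).cexp.const_mul C).fun_mul
      (L.differentiable_sigma 0).hasDerivAt
    simpa [deriv_sigma_zero] using h
  rw [h1.unique h2]
  exact hC

end PeriodPair

/-! ### Theta functions and the residue identity -/

namespace PeriodPair

variable (L : PeriodPair)

lemma countable_lattice : (L.lattice : Set ℂ).Countable :=
  Set.countable_coe_iff.mp (L.latticeEquivProd.toEquiv.countable_iff.mpr inferInstance)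

lemma countable_setOf_sub_mem_lattice (a : ℂ) : {u : ℂ | u - a ∈ L.lattice}.Countable :=
  L.countable_lattice.preimage (sub_left_injective (b := a))

/-- An entire function vanishing on a translate of the lattice is divisible by `σ`. -/
lemma exists_eq_mul_sigma {f : ℂ → ℂ} (hf : Differentiable ℂ f) (a : ℂ)
    (h : ∀ u, u - a ∈ L.lattice → f u = 0) :
    ∃ g : ℂ → ℂ, Differentiable ℂ g ∧ ∀ u, f u = g u * L.sigma (u - a) := by
  classical
  set S : ℂ → ℂ := fun u => L.sigma (u - a)
  have hS : Differentiable ℂ S := L.differentiable_sigma.comp (differentiable_id.sub_const a)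
  have hdS (u : ℂ) : deriv S u = deriv L.sigma (u - a) := deriv_comp_sub_const _ _ _
  let g : ℂ → ℂ := fun u => if u - a ∈ L.lattice then deriv f u / deriv S u else f u / S u
  refine ⟨g, fun u => ?_, fun u => ?_⟩
  · by_cases hu : u - a ∈ L.lattice
    -- At a zero of the denominator the quotient coincides nearby with the quotient of the
    -- difference quotients `dslope`, whose denominator does not vanish because the zero is simple.
    · have hdf : Differentiable ℂ (dslope f u) := by
        rw [← differentiableOn_univ] at hf ⊢
        exact (Complex.differentiableOn_dslope univ_mem).mpr hf
      have hdS' : Differentiable ℂ (dslope S u) := by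
        rw [← differentiableOn_univ] at hS ⊢
        exact (Complex.differentiableOn_dslope univ_mem).mpr hS
      have h0 : dslope S u u ≠ 0 := by
        rw [dslope_same, hdS]
        exact L.deriv_sigma_ne_zero hu
      refine ((hdf u).div (hdS' u) h0).congr_of_eventuallyEq ?_
      have h1 := L.compl_lattice_sdiff_singleton_mem_nhds (u - a)
      have h2 : Tendsto (fun v => v - a) (𝓝 u) (𝓝 (u - a)) :=
        (continuous_id.sub continuous_const).tendsto u
      filter_upwards [h2 h1] with v hv
      rcases eq_or_ne v u with rfl | hvu
      · simp [g, hu]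
      · have hv' : v - a ∉ L.lattice := fun h' => hv ⟨h', by simpa using hvu⟩
        have hvu' : v - u ≠ 0 := sub_ne_zero.mpr hvu
        have hSu : S u = 0 := L.sigma_eq_zero_iff.mpr hu
        simp only [g, if_neg hv', Pi.div_apply, dslope_of_ne _ hvu, slope_def_field, h u hu, hSu,
          sub_zero]
        field_simp
    · have hSu : S u ≠ 0 := L.sigma_ne_zero hu
      refine ((hf u).div (hS u) hSu).congr_of_eventuallyEq ?_
      have h2 : Tendsto (fun v => v - a) (𝓝 u) (𝓝 (u - a)) :=
        (continuous_id.sub continuous_const).tendsto u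
      filter_upwards [h2 (L.isClosed_lattice.isOpen_compl.mem_nhds hu)] with v hv
      simp only [g, Pi.div_apply]
      exact if_neg hv
  · by_cases hu : u - a ∈ L.lattice
    · rw [h u hu, L.sigma_eq_zero_iff.mpr hu, mul_zero]
    · simp only [g, if_neg hu]
      exact (div_mul_cancel₀ _ (L.sigma_ne_zero hu)).symm

/-- An entire elliptic function is constant. -/
lemma apply_eq_apply_of_periodic {h : ℂ → ℂ} (hd : Differentiable ℂ h)
    (hp : ∀ w ∈ L.lattice, ∀ u, h (u + w) = h u) (z w : ℂ) : h z = h w := by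
  refine hd.apply_eq_apply_of_bounded ?_ z w
  have hb := ZSpan.fundamentalDomain_isBounded L.basis
  have hK : IsCompact (closure (ZSpan.fundamentalDomain L.basis)) := hb.isCompact_closure
  refine (hK.image hd.continuous).isBounded.subset ?_
  rintro _ ⟨u, rfl⟩
  refine ⟨ZSpan.fract L.basis u, subset_closure (ZSpan.fract_mem_fundamentalDomain _ _), ?_⟩
  have hmem : -(ZSpan.floor L.basis u : ℂ) ∈ L.lattice := by
    rw [L.lattice_eq_span_range_basis]
    exact neg_mem (ZSpan.floor L.basis u).2
  rw [ZSpan.fract_apply, sub_eq_add_neg]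
  exact hp _ hmem u

/-- The theta function `σ(u - a) σ(u - b)` is determined up to a constant by its multipliers and
its zeros, if these are incongruent. -/
lemma exists_eq_const_mul_sigma_mul_sigma {G : ℂ → ℂ} (hG : Differentiable ℂ G) {a b : ℂ}
    (hab : a - b ∉ L.lattice) (m : ℂ → ℂ → ℂ)
    (hm : ∀ w ∈ L.lattice, ∀ u, m w u ≠ 0) (hmG : ∀ w ∈ L.lattice, ∀ u, G (u + w) = m w u * G u)
    (hms : ∀ w ∈ L.lattice, ∀ u, L.sigma (u + w - a) * L.sigma (u + w - b) =
      m w u * (L.sigma (u - a) * L.sigma (u - b)))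
    (ha : G a = 0) (hb : G b = 0) :
    ∃ c, ∀ u, G u = c * (L.sigma (u - a) * L.sigma (u - b)) := by
  have hvan (d : ℂ) (hd : G d = 0) (u : ℂ) (hu : u - d ∈ L.lattice) : G u = 0 := by
    have := hmG _ hu d
    rwa [hd, mul_zero, add_sub_cancel] at this
  obtain ⟨g, hg, hGg⟩ := L.exists_eq_mul_sigma hG a (hvan a ha)
  obtain ⟨h, hh, hgh⟩ := L.exists_eq_mul_sigma hg b fun u hu => by
    have h1 : u - a ∉ L.lattice := fun h' => hab (by
      have := sub_mem hu h'
      rwa [sub_sub_sub_cancel_left] at this)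
    have h2 := hGg u
    rw [hvan b hb u hu] at h2
    exact (mul_eq_zero.mp h2.symm).resolve_right (L.sigma_ne_zero h1)
  have hGh (u : ℂ) : G u = h u * (L.sigma (u - a) * L.sigma (u - b)) := by
    rw [hGg, hgh]
    ring
  have hper (w : ℂ) (hw : w ∈ L.lattice) : (fun u => h (u + w)) = h := by
    -- Off the zeros of the two sigma factors the multipliers cancel and `h` is periodic; density
    -- extends this to all points.
    have hdense : Dense ({u : ℂ | u - a ∈ L.lattice} ∪ {u : ℂ | u - b ∈ L.lattice})ᶜ :=
      ((L.countable_setOf_sub_mem_lattice a).union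
        (L.countable_setOf_sub_mem_lattice b)).dense_compl ℂ
    refine Continuous.ext_on hdense (hh.continuous.comp (continuous_id.add continuous_const))
      hh.continuous fun u hu => ?_
    simp only [mem_compl_iff, mem_union, mem_ofPred_eq, not_or] at hu
    have h1 := hmG w hw u
    rw [hGh, hGh, hms w hw, mul_left_comm] at h1
    exact mul_right_cancel₀
      (mul_ne_zero (L.sigma_ne_zero hu.1) (L.sigma_ne_zero hu.2))
      (mul_left_cancel₀ (hm w hw u) (by linear_combination h1))
  exact ⟨h 0, fun u => by
    rw [hGh, L.apply_eq_apply_of_periodic hh (fun w hw u => congrFun (hper w hw) u) u 0]⟩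

/-- The multiplier depends on the two zeros only through their sum `t`, so such products with
different `a` may be added without losing quasi-periodicity. -/
lemma exists_sigma_mul_sigma_add (t : ℂ) :
    ∃ m : ℂ → ℂ → ℂ, ∀ w ∈ L.lattice, ∀ u, m w u ≠ 0 ∧ ∀ a,
      L.sigma (u + w - a) * L.sigma (u + w - (t - a)) =
        m w u * (L.sigma (u - a) * L.sigma (u - (t - a))) := by
  have key (w : ℂ) : ∃ m : ℂ → ℂ, w ∈ L.lattice → ∀ u, m u ≠ 0 ∧ ∀ a,
      L.sigma (u + w - a) * L.sigma (u + w - (t - a)) =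
        m u * (L.sigma (u - a) * L.sigma (u - (t - a))) := by
    by_cases hw : w ∈ L.lattice
    · obtain ⟨A, C, hC, h⟩ := L.exists_sigma_add hw
      refine ⟨fun u => C ^ 2 * Complex.exp (A * (2 * u - t)), fun _ u =>
        ⟨mul_ne_zero (pow_ne_zero 2 hC) (Complex.exp_ne_zero _), fun a => ?_⟩⟩
      rw [show u + w - a = (u - a) + w by ring, show u + w - (t - a) = (u - (t - a)) + w by ring,
        h, h]
      simp only
      rw [show A * (2 * u - t) = A * (u - a) + A * (u - (t - a)) by ring, Complex.exp_add]
      ring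
    · exact ⟨fun _ => 0, fun h => absurd h hw⟩
  choose m hm using key
  exact ⟨m, fun w hw u => hm w hw u⟩

/-- The common term of the partial fraction identity for products of sigma functions. -/
noncomputable def sigmaTermRatio {ι : Type*} [DecidableEq ι] (s : Finset ι) (a : ι → ℂ)
    (B : Multiset ℂ) (j : ι) : ℂ :=
  (B.map fun b => L.sigma (a j - b)).prod / ∏ k ∈ s.erase j, L.sigma (a j - a k)

/-- With `t = b + c` fixed, let `b` vary: the sum becomes, up to sign, a second-order theta function
`G`, symmetric under `z ↦ t - z`. It vanishes at every `a m` by the identity for one point fewer, in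
which `b` and `c` are merged into `t - a m`. Its zeros `a i₁`, `t - a i₁` fix it up to a constant,
and the further incongruent zero `a i₂` makes this constant `0`. -/
lemma sum_sigmaTermRatio_of_generic {ι : Type*} [DecidableEq ι] {s : Finset ι} {a : ι → ℂ}
    (ha : ∀ i ∈ s, ∀ j ∈ s, i ≠ j → a i - a j ∉ L.lattice) (b c : ℂ) (B : Multiset ℂ)
    (ih : ∀ m ∈ s, ∑ j ∈ s.erase m, L.sigmaTermRatio (s.erase m) a ((b + c - a m) ::ₘ B) j = 0)
    {i₁ i₂ : ι} (h₁ : i₁ ∈ s) (h₂ : i₂ ∈ s) (h₁₂ : i₁ ≠ i₂)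
    (hb₁ : b + c - (a i₁ + a i₁) ∉ L.lattice) (hb₂ : b + c - (a i₁ + a i₂) ∉ L.lattice) :
    ∑ j ∈ s, L.sigmaTermRatio s a (b ::ₘ c ::ₘ B) j = 0 := by
  set t := b + c with ht
  let G : ℂ → ℂ := fun z => ∑ j ∈ s, L.sigma (z - a j) * L.sigma (z - (t - a j)) *
    L.sigmaTermRatio s a B j
  have hGd : Differentiable ℂ G := by
    refine Differentiable.fun_sum fun j _ => ?_
    have hd := L.differentiable_sigma
    fun_prop
  have hGt (z : ℂ) : G (t - z) = G z := by
    refine Finset.sum_congr rfl fun j _ => ?_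
    rw [show t - z - a j = -(z - (t - a j)) by ring, show t - z - (t - a j) = -(z - a j) by ring,
      L.sigma_neg, L.sigma_neg]
    ring
  have hGa (m : ι) (hm : m ∈ s) : G (a m) = 0 := by
    rw [← neg_eq_zero, ← ih m hm]
    simp only [G]
    rw [← Finset.add_sum_erase _ _ hm]
    simp only [sub_self, sigma_zero, zero_mul, zero_add]
    rw [← Finset.sum_neg_distrib]
    refine Finset.sum_congr rfl fun j hj => ?_
    obtain ⟨hjm, hj⟩ := Finset.mem_erase.mp hj
    have hne : L.sigma (a j - a m) ≠ 0 := L.sigma_ne_zero (ha j hj m hm hjm)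
    simp only [sigmaTermRatio, Multiset.map_cons, Multiset.prod_cons]
    rw [← Finset.mul_prod_erase (s.erase j) _ (Finset.mem_erase.mpr ⟨hjm.symm, hm⟩),
      Finset.erase_right_comm, show a m - a j = -(a j - a m) by ring, L.sigma_neg,
      show a m - (t - a j) = a j - (t - a m) by ring]
    field_simp
  obtain ⟨m, hm⟩ := L.exists_sigma_mul_sigma_add t
  obtain ⟨κ, hκ⟩ := L.exists_eq_const_mul_sigma_mul_sigma hGd (a := a i₁) (b := t - a i₁)
    (fun h => hb₁ (by
      have := neg_mem h
      rwa [show -(a i₁ - (t - a i₁)) = t - (a i₁ + a i₁) by ring] at this))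
    m (fun w hw u => (hm w hw u).1)
    (fun w hw u => by
      simp only [G, Finset.mul_sum]
      refine Finset.sum_congr rfl fun j _ => ?_
      rw [(hm w hw u).2]
      ring)
    (fun w hw u => (hm w hw u).2 _) (hGa i₁ h₁) (by rw [hGt, hGa i₁ h₁])
  have hκ0 : κ = 0 := by
    have h := hκ (a i₂)
    rw [hGa i₂ h₂] at h
    refine (mul_eq_zero.mp h.symm).resolve_right (mul_ne_zero ?_ ?_)
    · exact L.sigma_ne_zero (ha _ h₂ _ h₁ h₁₂.symm)
    · refine L.sigma_ne_zero fun h => hb₂ ?_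
      have := neg_mem h
      rwa [show -(a i₂ - (t - a i₁)) = t - (a i₁ + a i₂) by ring] at this
  have hGb : -G b = 0 := by rw [hκ, hκ0]; simp
  rw [← hGb]
  simp only [G]
  rw [← Finset.sum_neg_distrib]
  refine Finset.sum_congr rfl fun j _ => ?_
  simp only [sigmaTermRatio, Multiset.map_cons, Multiset.prod_cons]
  rw [show b - (t - a j) = a j - c by rw [ht]; ring, show b - a j = -(a j - b) by ring, L.sigma_neg]
  ring

/-- The residue theorem for `∏ σ(u - b) / ∏ σ(u - aⱼ)` with `∑ b = ∑ aⱼ`. -/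
theorem sum_sigmaTermRatio {ι : Type*} [DecidableEq ι] {a : ι → ℂ} (s : Finset ι)
    (B : Multiset ℂ) (hcard : B.card = s.card)
    (ha : ∀ i ∈ s, ∀ j ∈ s, i ≠ j → a i - a j ∉ L.lattice) (hsum : B.sum = ∑ j ∈ s, a j) :
    ∑ j ∈ s, L.sigmaTermRatio s a B j = 0 := by
  induction hn : s.card generalizing s B with
  | zero =>
    rw [Finset.card_eq_zero] at hn
    simp [hn]
  | succ n ih =>
    rw [hn] at hcard
    have hne : s.Nonempty := Finset.card_pos.mp (by omega)
    obtain ⟨i₁, h₁⟩ := hne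
    -- With one point the balance condition puts the zero on the pole, and `σ(0) = 0`.
    rcases n with _ | n
    · obtain ⟨b, rfl⟩ := Multiset.card_eq_one.mp hcard
      obtain ⟨i, rfl⟩ := Finset.card_eq_one.mp hn
      simp only [Multiset.sum_singleton, Finset.sum_singleton] at hsum
      simp [sigmaTermRatio, hsum]
    obtain ⟨i₂, h₂, h₂₁⟩ := Finset.exists_mem_ne (s := s) (by omega) i₁
    -- With two points oddness suffices. This case stands apart because the perturbation used for
    -- larger sets needs a third zero `d`.
    rcases n with _ | n
    · obtain ⟨b, c, rfl⟩ := Multiset.card_eq_two.mp hcard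
      have hs : s = {i₁, i₂} := by
        symm
        refine Finset.eq_of_subset_of_card_le ?_ ?_
        · intro i hi
          rcases Finset.mem_insert.mp hi with rfl | hi
          · exact h₁
          · rwa [Finset.mem_singleton.mp hi]
        · rw [Finset.card_pair h₂₁.symm]
          omega
      subst hs
      have e1 : ({i₁, i₂} : Finset ι).erase i₁ = {i₂} := by
        ext; simp; grind
      have e2 : ({i₁, i₂} : Finset ι).erase i₂ = {i₁} := by
        ext; simp; grind
      rw [Finset.sum_pair h₂₁.symm] at hsum ⊢
      have hc : c = a i₁ + a i₂ - b := by
        rw [← hsum]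
        simp
      simp only [sigmaTermRatio, e1, e2, Finset.prod_singleton]
      simp only [Multiset.insert_eq_cons, Multiset.map_cons, Multiset.map_singleton,
        Multiset.prod_cons, Multiset.prod_singleton]
      rw [hc, show a i₁ - (a i₁ + a i₂ - b) = -(a i₂ - b) by ring,
        show a i₂ - (a i₁ + a i₂ - b) = -(a i₁ - b) by ring,
        show a i₂ - a i₁ = -(a i₁ - a i₂) by ring, L.sigma_neg, L.sigma_neg, L.sigma_neg]
      ring
    · obtain ⟨b, hmem⟩ := Multiset.card_pos_iff_exists_mem.mp (by omega : 0 < B.card)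
      obtain ⟨B₁, rfl⟩ := Multiset.exists_cons_of_mem hmem
      clear hmem
      rw [Multiset.card_cons] at hcard
      obtain ⟨c, hmem⟩ := Multiset.card_pos_iff_exists_mem.mp (by omega : 0 < B₁.card)
      obtain ⟨B₂, rfl⟩ := Multiset.exists_cons_of_mem hmem
      clear hmem
      rw [Multiset.card_cons] at hcard
      obtain ⟨d, hmem⟩ := Multiset.card_pos_iff_exists_mem.mp (by omega : 0 < B₂.card)
      obtain ⟨B₃, rfl⟩ := Multiset.exists_cons_of_mem hmem
      clear hmem
      rw [Multiset.card_cons] at hcard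
      -- Moving `b` by `e` and `d` by `-e` keeps the balance. For `e` outside two translates of the
      -- lattice the genericity conditions hold, and continuity returns to `e = 0`.
      have hdense : Dense ({e : ℂ | e - (a i₁ + a i₁ - b - c) ∈ L.lattice} ∪
          {e : ℂ | e - (a i₁ + a i₂ - b - c) ∈ L.lattice})ᶜ :=
        ((L.countable_setOf_sub_mem_lattice _).union
          (L.countable_setOf_sub_mem_lattice _)).dense_compl ℂ
      have hcont : Continuous fun e : ℂ =>
          ∑ j ∈ s, L.sigmaTermRatio s a ((b + e) ::ₘ c ::ₘ (d - e) ::ₘ B₃) j := by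
        simp only [sigmaTermRatio, Multiset.map_cons, Multiset.prod_cons]
        have := L.continuous_sigma
        fun_prop
      have key := Continuous.ext_on hdense hcont (continuous_const (y := (0 : ℂ))) fun e he => by
        simp only [mem_compl_iff, mem_union, mem_ofPred_eq, not_or] at he
        refine L.sum_sigmaTermRatio_of_generic ha (b + e) c ((d - e) ::ₘ B₃) (fun m hm => ?_)
          h₁ h₂ h₂₁.symm ?_ ?_
        · have hcm : (s.erase m).card = n + 1 + 1 := by
            rw [Finset.card_erase_of_mem hm, hn]
            omega
          refine ih (s.erase m) _ ?_ (fun i hi j hj => ha i (Finset.mem_of_mem_erase hi) j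
            (Finset.mem_of_mem_erase hj)) ?_ hcm
          · rw [Multiset.card_cons, Multiset.card_cons, hcm]
            omega
          · have := Finset.add_sum_erase s a hm
            simp only [Multiset.sum_cons] at hsum ⊢
            linear_combination hsum - this
        · rw [show b + e + c - (a i₁ + a i₁) = e - (a i₁ + a i₁ - b - c) by ring]
          exact he.1
        · rw [show b + e + c - (a i₁ + a i₂) = e - (a i₁ + a i₂ - b - c) by ring]
          exact he.2
      simpa using congrFun key 0

end PeriodPair

/-! ### The Lax matrix at a turning point -/

namespace RuijsenaarsSchneider

variable {N : ℕ} (L : PeriodPair) (η : ℂ) (x p : Fin N → ℂ)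

/-- The summands in the entries of `Lᵀ(lam) U L(mu) U⁻¹`, without the factors that do not depend
on `j`. -/
noncomputable def laxProductTerm (lam mu : ℂ) (i k j : Fin N) : ℂ :=
  (∏ l ∈ Finset.univ.erase j, L.sigma (x j - x l - η) / L.sigma (x j - x l)) *
    (L.sigma (x j - x i - η + lam) * L.sigma (x j - x k - η + mu) /
      (L.sigma (x j - x i - η) * L.sigma (x j - x k - η)))

variable {L η x}

lemma sigma_sub_sub_ne_zero (hη : η ∉ L.lattice)
    (hxη : ∀ i j, i ≠ j → x i - x j - η ∉ L.lattice) (i j : Fin N) :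
    L.sigma (x i - x j - η) ≠ 0 := by
  refine L.sigma_ne_zero ?_
  rcases eq_or_ne i j with rfl | h
  · simpa using hη
  · exact hxη i j h

lemma sigma_sub_add_ne_zero (hη : η ∉ L.lattice)
    (hxη : ∀ i j, i ≠ j → x i - x j - η ∉ L.lattice) (i j : Fin N) :
    L.sigma (x i - x j + η) ≠ 0 := by
  have h := sigma_sub_sub_ne_zero hη hxη j i
  rw [show x j - x i - η = -(x i - x j + η) by ring, L.sigma_neg] at h
  exact neg_ne_zero.mp h

/-- The denominators `σ(x_j - x_i - η)` and `σ(x_j - x_k - η)` cancel two factors of the numerator,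
leaving poles only at the `x_j`. The `N` zeros `B` balance them precisely when `lam + mu = N * η`.
The factor `σ(-η)` supplies the index `l = j` missing from the product. -/
lemma sum_laxProductTerm_of_ne (hη : η ∉ L.lattice)
    (hx : ∀ i j, i ≠ j → x i - x j ∉ L.lattice)
    (hxη : ∀ i j, i ≠ j → x i - x j - η ∉ L.lattice) {lam mu : ℂ} (h : lam + mu = N * η)
    {i k : Fin N} (hik : i ≠ k) :
    ∑ j, laxProductTerm L η x lam mu i k j = 0 := by
  have hki : k ∈ Finset.univ.erase i := Finset.mem_erase.mpr ⟨hik.symm, Finset.mem_univ _⟩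
  have hη0 : L.sigma (-η) ≠ 0 := L.sigma_ne_zero (by simpa using hη)
  set B : Multiset ℂ := (x i + η - lam) ::ₘ (x k + η - mu) ::ₘ
    ((Finset.univ.erase i).erase k).val.map fun l => x l + η with hB
  have hcard : (((Finset.univ : Finset (Fin N)).erase i).erase k).card + 1 + 1 = N := by
    rw [Finset.card_erase_add_one hki, Finset.card_erase_add_one (Finset.mem_univ i)]
    simp
  have key := L.sum_sigmaTermRatio (a := x) Finset.univ B
    (by
      simp only [hB, Multiset.card_cons, Multiset.card_map, Finset.card_val, Finset.card_univ,
        Fintype.card_fin]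
      exact hcard)
    (fun i _ j _ => hx i j)
    (by
      have h1 := Finset.add_sum_erase Finset.univ (fun l => x l + η) (Finset.mem_univ i)
      have h2 := Finset.add_sum_erase (Finset.univ.erase i) (fun l => x l + η) hki
      rw [Finset.sum_add_distrib (s := Finset.univ)] at h1
      simp only [Finset.sum_const, Finset.card_univ, Fintype.card_fin, nsmul_eq_mul] at h1
      simp only [hB, Multiset.sum_cons]
      change _ + (_ + ∑ l ∈ (Finset.univ.erase i).erase k, (x l + η)) = _
      linear_combination h1 + h2 - h)
  refine (mul_eq_zero.mp (?_ : L.sigma (-η) * _ = 0)).resolve_left hη0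
  rw [← key, Finset.mul_sum]
  refine Finset.sum_congr rfl fun j _ => ?_
  simp only [PeriodPair.sigmaTermRatio, laxProductTerm, hB, Multiset.map_cons, Multiset.prod_cons,
    Multiset.map_map, Function.comp_def]
  change _ = _ * (_ * ∏ l ∈ (Finset.univ.erase i).erase k, L.sigma (x j - (x l + η))) / _
  have h1 := Finset.mul_prod_erase Finset.univ (fun l => L.sigma (x j - x l - η))
    (Finset.mem_univ i)
  have h2 := Finset.mul_prod_erase (Finset.univ.erase i) (fun l => L.sigma (x j - x l - η)) hki
  have h3 := Finset.mul_prod_erase Finset.univ (fun l => L.sigma (x j - x l - η))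
    (Finset.mem_univ j)
  rw [← h1, ← h2] at h3
  simp only [sub_self, zero_sub] at h3
  have n1 := sigma_sub_sub_ne_zero hη hxη j i
  have n2 := sigma_sub_sub_ne_zero hη hxη j k
  have n3 : ∏ l ∈ Finset.univ.erase j, L.sigma (x j - x l) ≠ 0 :=
    Finset.prod_ne_zero_iff.mpr fun l hl =>
      L.sigma_ne_zero (hx j l (Finset.ne_of_mem_erase hl).symm)
  rw [Finset.prod_div_distrib, show x j - (x i + η - lam) = x j - x i - η + lam by ring,
    show x j - (x k + η - mu) = x j - x k - η + mu by ring]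
  simp only [← sub_sub]
  field_simp
  linear_combination L.sigma (x j - x i - η + lam) * L.sigma (x j - x k - η + mu) * h3

/-- For `i = k` the denominator is a square and only one of its factors cancels. The extra pole at
`x i + η`, indexed by `none`, has the right-hand side as its residue, up to a factor depending on
`η`. -/
lemma sum_laxProductTerm_self (hη : η ∉ L.lattice)
    (hx : ∀ i j, i ≠ j → x i - x j ∉ L.lattice)
    (hxη : ∀ i j, i ≠ j → x i - x j - η ∉ L.lattice) {lam mu : ℂ} (h : lam + mu = N * η)
    (i : Fin N) :
    L.sigma η ^ 2 * ∑ j, laxProductTerm L η x lam mu i i j =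
      L.sigma lam * L.sigma mu *
        ∏ l ∈ Finset.univ.erase i, L.sigma (x i - x l) / L.sigma (x i - x l + η) := by
  have hη0 : L.sigma η ≠ 0 := L.sigma_ne_zero hη
  set B : Multiset ℂ := (x i + η - lam) ::ₘ (x i + η - mu) ::ₘ
    (Finset.univ.erase i).val.map fun l => x l + η with hB
  set a : Option (Fin N) → ℂ := fun o => o.elim (x i + η) x with ha
  have hcard : ((Finset.univ : Finset (Fin N)).erase i).card + 1 = N := by
    rw [Finset.card_erase_add_one (Finset.mem_univ i)]
    simp
  have hnone (j : Fin N) : x i + η - x j ∉ L.lattice := fun h' =>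
    sigma_sub_add_ne_zero hη hxη i j (L.sigma_eq_zero_iff.mpr (by
      rwa [show x i - x j + η = x i + η - x j by ring]))
  have key := L.sum_sigmaTermRatio (a := a) Finset.univ B
    (by
      simp only [hB, Multiset.card_cons, Multiset.card_map, Finset.card_val, Finset.card_univ,
        Fintype.card_option, Fintype.card_fin]
      rw [hcard])
    (by
      rintro (_ | j) _ (_ | k) _ hjk
      · exact absurd rfl hjk
      · exact hnone k
      · intro h'
        have := neg_mem h'
        rw [neg_sub] at this
        exact hnone j this
      · exact hx j k fun h' => hjk (congrArg some h'))
    (by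
      have h1 := Finset.add_sum_erase Finset.univ (fun l => x l + η) (Finset.mem_univ i)
      rw [Finset.sum_add_distrib (s := Finset.univ)] at h1
      simp only [Finset.sum_const, Finset.card_univ, Fintype.card_fin, nsmul_eq_mul] at h1
      simp only [hB, Multiset.sum_cons, Fintype.sum_option, ha, Option.elim]
      change _ + (_ + ∑ l ∈ Finset.univ.erase i, (x l + η)) = _
      linear_combination h1 - h)
  rw [Fintype.sum_option] at key
  have hsome (j : Fin N) : L.sigmaTermRatio Finset.univ a B (some j) =
      -L.sigma η * laxProductTerm L η x lam mu i i j := by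
    have he : (Finset.univ : Finset (Option (Fin N))).erase (some j) =
        Finset.insertNone (Finset.univ.erase j) := by
      ext o
      cases o <;> simp
    simp only [PeriodPair.sigmaTermRatio, laxProductTerm, hB, Multiset.map_cons,
      Multiset.prod_cons, Multiset.map_map, Function.comp_def, he, Finset.prod_insertNone, ha,
      Option.elim]
    change _ * (_ * ∏ l ∈ Finset.univ.erase i, L.sigma (x j - (x l + η))) / _ = _
    have h1 := Finset.mul_prod_erase Finset.univ (fun l => L.sigma (x j - x l - η))
      (Finset.mem_univ i)
    have h3 := Finset.mul_prod_erase Finset.univ (fun l => L.sigma (x j - x l - η))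
      (Finset.mem_univ j)
    rw [← h1] at h3
    simp only [sub_self, zero_sub, L.sigma_neg] at h3
    have n1 := sigma_sub_sub_ne_zero hη hxη j i
    have n3 : ∏ l ∈ Finset.univ.erase j, L.sigma (x j - x l) ≠ 0 :=
      Finset.prod_ne_zero_iff.mpr fun l hl =>
        L.sigma_ne_zero (hx j l (Finset.ne_of_mem_erase hl).symm)
    rw [Finset.prod_div_distrib, show x j - (x i + η - lam) = x j - x i - η + lam by ring,
      show x j - (x i + η - mu) = x j - x i - η + mu by ring]
    simp only [← sub_sub]
    field_simp
    linear_combination -L.sigma (x j - x i - η + lam) * L.sigma (x j - x i - η + mu) * h3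
  have hnone' : L.sigmaTermRatio Finset.univ a B none = L.sigma lam * L.sigma mu *
      (∏ l ∈ Finset.univ.erase i, L.sigma (x i - x l) / L.sigma (x i - x l + η)) / L.sigma η := by
    have he : (Finset.univ : Finset (Option (Fin N))).erase none =
        Finset.univ.map Function.Embedding.some := by
      ext o
      cases o <;> simp
    simp only [PeriodPair.sigmaTermRatio, hB, Multiset.map_cons,
      Multiset.prod_cons, Multiset.map_map, Function.comp_def, he, Finset.prod_map, ha,
      Option.elim, Function.Embedding.some_apply]
    change _ * (_ * ∏ l ∈ Finset.univ.erase i, L.sigma (x i + η - (x l + η))) / _ = _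
    rw [← Finset.mul_prod_erase Finset.univ _ (Finset.mem_univ i), Finset.prod_div_distrib]
    have e1 (l : Fin N) : x i + η - (x l + η) = x i - x l := by ring
    have e2 (l : Fin N) : x i + η - x l = x i - x l + η := by ring
    simp only [e1, e2, sub_sub_cancel, sub_self, zero_add]
    ring
  rw [hnone', Finset.sum_congr rfl fun j _ => hsome j, ← Finset.mul_sum] at key
  field_simp at key
  linear_combination -key

lemma velocity_sq (hturn : IsTurningPoint L η x p) (j : Fin N) :
    velocity L η x p j ^ 2 = L.sigma η ^ 2 *
      (∏ l ∈ Finset.univ.erase j, L.sigma (x j - x l + η) / L.sigma (x j - x l)) *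
      ∏ l ∈ Finset.univ.erase j, L.sigma (x j - x l - η) / L.sigma (x j - x l) := by
  have h1 : velocity L η x p j ^ 2 = velocity L η x p j * -velocityBar L η x p j := by
    rw [sq, ← eq_neg_of_add_eq_zero_left (hturn j)]
  rw [h1, velocity_eq, velocityBar_eq, neg_neg]
  have h2 : Complex.exp (p j) * Complex.exp (-p j) = 1 := by
    rw [← Complex.exp_add, add_neg_cancel, Complex.exp_zero]
  linear_combination (L.sigma η ^ 2 *
      (∏ l ∈ Finset.univ.erase j, L.sigma (x j - x l + η) / L.sigma (x j - x l)) *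
      ∏ l ∈ Finset.univ.erase j, L.sigma (x j - x l - η) / L.sigma (x j - x l)) * h2

lemma prod_sigma_div_ne_zero (hη : η ∉ L.lattice) (hx : ∀ i j, i ≠ j → x i - x j ∉ L.lattice)
    (hxη : ∀ i j, i ≠ j → x i - x j - η ∉ L.lattice) (i : Fin N) :
    ∏ k ∈ Finset.univ.erase i, L.sigma (x i - x k) / L.sigma (x i - x k + η) ≠ 0 :=
  Finset.prod_ne_zero_iff.mpr fun k hk =>
    div_ne_zero (L.sigma_ne_zero (hx i k (Finset.ne_of_mem_erase hk).symm))
      (sigma_sub_add_ne_zero hη hxη i k)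

lemma gaugeDiag_ne_zero (hη : η ∉ L.lattice) (hx : ∀ i j, i ≠ j → x i - x j ∉ L.lattice)
    (hxη : ∀ i j, i ≠ j → x i - x j - η ∉ L.lattice) (lam : ℂ) (i : Fin N) :
    gaugeDiag L η x lam i ≠ 0 :=
  mul_ne_zero (Complex.exp_ne_zero _) (prod_sigma_div_ne_zero hη hx hxη i)

/-- The four exponentials combine to one free of `j`, and `ẋ_j²` times the product in `U_j` leaves
only the `-η` product of `laxProductTerm`. -/
lemma laxMatrix_mul_gaugeDiag_mul (hη : η ∉ L.lattice)
    (hx : ∀ i j, i ≠ j → x i - x j ∉ L.lattice)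
    (hxη : ∀ i j, i ≠ j → x i - x j - η ∉ L.lattice)
    (hturn : IsTurningPoint L η x p) {lam : ℂ} (hl : lam ∉ L.lattice)
    (hm : N * η - lam ∉ L.lattice) (i k j : Fin N) :
    laxMatrix L η x p lam j i * gaugeDiag L η x lam j * laxMatrix L η x p (N * η - lam) j k *
        (gaugeDiag L η x lam k)⁻¹ =
      Complex.exp ((x i - x k) * L.zeta lam) * L.sigma η ^ 2 /
        ((∏ l ∈ Finset.univ.erase k, L.sigma (x k - x l) / L.sigma (x k - x l + η)) *
          L.sigma lam * L.sigma (N * η - lam)) *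
        laxProductTerm L η x lam (N * η - lam) i k j := by
  have hP := prod_sigma_div_ne_zero hη hx hxη
  simp only [laxMatrix, Matrix.of_apply, gaugeDiag, laxProductTerm]
  have hv := velocity_sq p hturn j
  set mu := N * η - lam
  set Q := ∏ l ∈ Finset.univ.erase j, L.sigma (x j - x l - η) / L.sigma (x j - x l)
  set P := fun i => ∏ k ∈ Finset.univ.erase i, L.sigma (x i - x k) / L.sigma (x i - x k + η)
    with hPdef
  have hPinv : ∏ l ∈ Finset.univ.erase j, L.sigma (x j - x l + η) / L.sigma (x j - x l) =
      (P j)⁻¹ := by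
    rw [hPdef, ← Finset.prod_inv_distrib]
    simp only [inv_div]
  rw [hPinv] at hv
  have hPj : P j ≠ 0 := hP j
  have hPk : P k ≠ 0 := hP k
  have n1 := L.sigma_ne_zero hl
  have n2 : L.sigma mu ≠ 0 := L.sigma_ne_zero hm
  have n3 := sigma_sub_sub_ne_zero hη hxη j i
  have n4 := sigma_sub_sub_ne_zero hη hxη j k
  have hE : Complex.exp (-(x j - x i) * L.zeta lam) *
      Complex.exp (x j * (L.zeta lam + L.zeta mu)) * Complex.exp (-(x j - x k) * L.zeta mu) *
      (Complex.exp (x k * (L.zeta lam + L.zeta mu)))⁻¹ =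
      Complex.exp ((x i - x k) * L.zeta lam) := by
    rw [← Complex.exp_neg, ← Complex.exp_add, ← Complex.exp_add, ← Complex.exp_add]
    congr 1
    ring
  have hv' : velocity L η x p j ^ 2 * P j = L.sigma η ^ 2 * Q := by
    rw [hv]
    field_simp
  rw [← hE, mul_inv]
  change Complex.exp _ * _ * (_ / _) * (_ * P j) * (_ * _ * (_ / _)) * (_ * (P k)⁻¹) =
    _ * _ / (P k * _ * _) * _
  generalize Complex.exp (-(x j - x i) * L.zeta lam) = e1
  generalize Complex.exp (x j * (L.zeta lam + L.zeta mu)) = e2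
  generalize Complex.exp (-(x j - x k) * L.zeta mu) = e3
  generalize (Complex.exp (x k * (L.zeta lam + L.zeta mu)))⁻¹ = e4
  generalize L.sigma (x j - x i - η + lam) = s1
  generalize L.sigma (x j - x k - η + mu) = s2
  generalize L.sigma (x j - x i - η) = s3 at *
  generalize L.sigma (x j - x k - η) = s4 at *
  calc _ = e1 * e2 * e3 * e4 * s1 * s2 / (P k * L.sigma lam * L.sigma mu * s3 * s4) *
        (velocity L η x p j ^ 2 * P j) := by
        field_simp
    _ = _ := by
        rw [hv']
        field_simp

lemma laxMatrix_transpose_mul (hη : η ∉ L.lattice)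
    (hx : ∀ i j, i ≠ j → x i - x j ∉ L.lattice)
    (hxη : ∀ i j, i ≠ j → x i - x j - η ∉ L.lattice)
    (hturn : IsTurningPoint L η x p) {lam : ℂ} (hl : lam ∉ L.lattice)
    (hm : N * η - lam ∉ L.lattice) :
    (laxMatrix L η x p lam).transpose * (Matrix.diagonal (gaugeDiag L η x lam) *
      laxMatrix L η x p (N * η - lam) * Matrix.diagonal fun i => (gaugeDiag L η x lam i)⁻¹) =
      1 := by
  ext i k
  rw [← Matrix.mul_assoc, ← Matrix.mul_assoc, Matrix.mul_diagonal, Matrix.mul_apply,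
    Finset.sum_mul]
  simp only [Matrix.mul_diagonal, Matrix.transpose_apply]
  rw [Finset.sum_congr rfl fun j _ => laxMatrix_mul_gaugeDiag_mul p hη hx hxη hturn hl hm i k j,
    ← Finset.mul_sum]
  have hsum : lam + (N * η - lam) = N * η := by ring
  rcases eq_or_ne i k with rfl | hik
  · have h := sum_laxProductTerm_self hη hx hxη hsum i
    have hP := prod_sigma_div_ne_zero hη hx hxη i
    have n1 := L.sigma_ne_zero hl
    have n2 := L.sigma_ne_zero hm
    rw [mul_div_assoc, mul_assoc, div_mul_eq_mul_div, h, sub_self, zero_mul, Complex.exp_zero,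
      one_mul, Matrix.one_apply_eq]
    field_simp
  · rw [sum_laxProductTerm_of_ne hη hx hxη hsum hik, mul_zero, Matrix.one_apply_ne hik]

lemma diagonal_gaugeDiag_inv (hη : η ∉ L.lattice)
    (hx : ∀ i j, i ≠ j → x i - x j ∉ L.lattice)
    (hxη : ∀ i j, i ≠ j → x i - x j - η ∉ L.lattice) (lam : ℂ) :
    Matrix.diagonal (gaugeDiag L η x lam) *
      Matrix.diagonal (fun i => (gaugeDiag L η x lam i)⁻¹) = 1 := by
  rw [Matrix.diagonal_mul_diagonal, ← Matrix.diagonal_one]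
  congr 1
  funext i
  exact mul_inv_cancel₀ (gaugeDiag_ne_zero hη hx hxη lam i)

/-- At a turning point, `L(Nη - lam)` is conjugate to the inverse transpose of `L(lam)`. -/
theorem laxMatrix_transpose_inv (hη : η ∉ L.lattice)
    (hx : ∀ i j, i ≠ j → x i - x j ∉ L.lattice)
    (hxη : ∀ i j, i ≠ j → x i - x j - η ∉ L.lattice)
    (hturn : IsTurningPoint L η x p) {lam : ℂ} (hl : lam ∉ L.lattice)
    (hm : N * η - lam ∉ L.lattice) :
    IsUnit (laxMatrix L η x p lam) ∧ IsUnit (Matrix.diagonal (gaugeDiag L η x lam)) ∧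
      ((laxMatrix L η x p lam).transpose)⁻¹ =
        Matrix.diagonal (gaugeDiag L η x lam) * laxMatrix L η x p (N * η - lam) *
          (Matrix.diagonal (gaugeDiag L η x lam))⁻¹ := by
  have hU := diagonal_gaugeDiag_inv hη hx hxη lam
  have h := laxMatrix_transpose_mul p hη hx hxη hturn hl hm
  refine ⟨?_, IsUnit.of_mul_eq_one _ hU, ?_⟩
  · rw [← Matrix.isUnit_transpose]
    exact IsUnit.of_mul_eq_one _ h
  · rw [Matrix.inv_eq_right_inv hU, Matrix.inv_eq_right_inv h]

end RuijsenaarsSchneider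

/-! ### Inversion of the sphere and perturbation of roots -/

namespace RiemannSphere

/-- Locally the inversion goes up one chart and down the other, because the charts differ by it. -/
lemma mdifferentiable_inv : MDifferentiable 𝓘(ℂ, ℂ) 𝓘(ℂ, ℂ) inv := by
  have h0 : chartZero ∈ atlas ℂ (OnePoint ℂ) := Or.inl rfl
  have h1 : chartInfty ∈ atlas ℂ (OnePoint ℂ) := Or.inr rfl
  intro w
  induction w using OnePoint.rec with
  | infty =>
    have hsrc : OnePoint.infty ∈ chartInfty.source := mem_chart_source ℂ (OnePoint.infty : OnePoint ℂ)
    have h2 := mdifferentiableAt_atlas (I := 𝓘(ℂ, ℂ)) h1 hsrc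
    have h3 := mdifferentiableAt_atlas_symm (I := 𝓘(ℂ, ℂ)) h0
      (x := chartInfty OnePoint.infty) (by simp [chartZero])
    refine (h3.comp _ h2).congr_of_eventuallyEq ?_
    filter_upwards [chartInfty.open_source.mem_nhds hsrc] with v hv
    have hv' : inv v ∈ chartZero.source := by
      simpa [chartInfty, invHomeomorph] using hv
    exact (chartZero.left_inv hv').symm
  | coe z =>
    have hsrc : (z : OnePoint ℂ) ∈ chartZero.source := by simp [chartZero_source]
    have h2 := mdifferentiableAt_atlas (I := 𝓘(ℂ, ℂ)) h0 hsrc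
    have h3 := mdifferentiableAt_atlas_symm (I := 𝓘(ℂ, ℂ)) h1
      (x := chartZero (z : OnePoint ℂ)) (by simp [chartInfty, chartZero])
    refine (h3.comp _ h2).congr_of_eventuallyEq ?_
    filter_upwards [chartZero.open_source.mem_nhds hsrc] with v hv
    change inv v = inv (chartZero.symm (chartZero v))
    rw [chartZero.left_inv hv]

end RiemannSphere

lemma Multiset.pow_card_le_norm_prod_sub {z : ℂ} {ε : ℝ} (hε : 0 ≤ ε) (s : Multiset ℂ)
    (h : ∀ r ∈ s, ε ≤ ‖z - r‖) : ε ^ s.card ≤ ‖(s.map fun r => z - r).prod‖ := by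
  induction s using Multiset.induction with
  | empty => simp
  | cons a s ih =>
    rw [Multiset.card_cons, Multiset.map_cons, Multiset.prod_cons, norm_mul, pow_succ, mul_comm]
    exact mul_le_mul (h a (Multiset.mem_cons_self a s))
      (ih fun r hr => h r (Multiset.mem_cons_of_mem hr)) (by positivity) (norm_nonneg _)

/-- The value of a monic polynomial at `z` is the product of the differences from its roots, so a
small value forces a nearby root. Applied to characteristic polynomials, it lets eigenvalues follow
the spectral parameter. -/
lemma Polynomial.Monic.exists_isRoot_norm_sub_lt {P : Polynomial ℂ} (hP : P.Monic) {z : ℂ}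
    {ε : ℝ} (hε : 0 ≤ ε) (h : ‖P.eval z‖ < ε ^ P.natDegree) : ∃ r, P.IsRoot r ∧ ‖z - r‖ < ε := by
  by_contra! hcon
  have hs := IsAlgClosed.splits P
  have h1 := Multiset.pow_card_le_norm_prod_sub hε P.roots fun r hr =>
    hcon r (Polynomial.isRoot_of_mem_roots hr)
  rw [← hs.natDegree_eq_card_roots] at h1
  have h2 : P.eval z = (P.roots.map fun r => z - r).prod := by
    rw [hs.eval_eq_prod_roots, hP.leadingCoeff, one_mul]
  rw [h2] at h
  exact absurd h (not_lt.mpr h1)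

namespace PeriodPair

lemma continuousAt_zeta (L : PeriodPair) {lam : ℂ} (h : lam ∉ L.lattice) :
    ContinuousAt L.zeta lam :=
  (L.differentiable_sigma.contDiff (n := 1)).continuous_deriv_one.continuousAt.div
    L.continuous_sigma.continuousAt (L.sigma_ne_zero h)

end PeriodPair

/-! ### The involution of the spectral curve -/

namespace RuijsenaarsSchneider

variable {N : ℕ} (L : PeriodPair) (η : ℂ) (x p : Fin N → ℂ)

lemma continuousAt_charFun (z : ℂ) {lam : ℂ} (h : lam ∉ L.lattice) :
    ContinuousAt (charFun L η x p z) lam := by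
  have hM : ContinuousAt (fun l => z • (1 : Matrix (Fin N) (Fin N) ℂ) - laxMatrix L η x p l) lam := by
    refine continuousAt_const.sub ?_
    refine continuousAt_pi.mpr fun i => continuousAt_pi.mpr fun j => ?_
    simp only [laxMatrix, Matrix.of_apply, div_eq_mul_inv, mul_inv]
    have h1 := L.continuousAt_zeta h
    have h2 : ContinuousAt (fun l => (L.sigma l)⁻¹) lam :=
      L.continuous_sigma.continuousAt.inv₀ (L.sigma_ne_zero h)
    have h3 : Continuous fun l => L.sigma (x i - x j - η + l) :=
      L.continuous_sigma.comp (by fun_prop)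
    have h4 := h3.continuousAt (x := lam)
    fun_prop
  exact (continuous_id.matrix_det.continuousAt (x := _)).comp hM

lemma charFun_eq_eval_charpoly (z lam : ℂ) :
    charFun L η x p z lam = (laxMatrix L η x p lam).charpoly.eval z := by
  rw [Matrix.eval_charpoly, charFun, Matrix.scalar_apply, Matrix.smul_one_eq_diagonal]

/-- The affine part of the spectral cover, over a set `S` of spectral parameters. -/
def affineSpectralCover (S : Set ℂ) : Set (OnePoint ℂ × ℂ) :=
  {P | ∃ z lam : ℂ, P = ((z : OnePoint ℂ), lam) ∧ lam ∈ S ∧ charFun L η x p z lam = 0}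

/-- The spectral cover is the closure of its part over any dense set of spectral parameters. -/
lemma spectralCover_subset_closure {S : Set ℂ} (hS : Dense S) :
    spectralCover L η x p ⊆
      closure (affineSpectralCover L η x p ((L.lattice : Set ℂ)ᶜ ∩ S)) := by
  refine closure_minimal ?_ isClosed_closure
  rintro _ ⟨z, lam, rfl, hl, hz⟩
  let T : Set (ℂ × ℂ) :=
    {q | q.2 ∈ (L.lattice : Set ℂ)ᶜ ∩ S ∧ charFun L η x p q.1 q.2 = 0}
  have hT : (z, lam) ∈ closure T := by
    rw [Metric.mem_closure_iff]
    intro ε hε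
    -- The bound `ε ^ N` matches the degree `N` of the characteristic polynomial, which then has a
    -- root within `ε` of `z` at a nearby parameter in `S`.
    have h1 : ∀ᶠ l in 𝓝 lam, l ∉ L.lattice ∧ dist l lam < ε ∧
        ‖charFun L η x p z l‖ < ε ^ N := by
      have hl' : ∀ᶠ l in 𝓝 lam, l ∉ L.lattice := L.isClosed_lattice.isOpen_compl.mem_nhds hl
      have hd : ∀ᶠ l in 𝓝 lam, dist l lam < ε := Metric.ball_mem_nhds lam hε
      refine hl'.and (hd.and ?_)
      have := (continuousAt_charFun L η x p z hl).norm
      refine this.eventually_lt_const ?_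
      simp only [hz, norm_zero]
      positivity
    obtain ⟨l, hlS, hl1, hl2, hl3⟩ := hS.inter_nhds_nonempty h1
    rw [charFun_eq_eval_charpoly] at hl3
    obtain ⟨r, hr, hzr⟩ := (Matrix.charpoly_monic
      (laxMatrix L η x p l)).exists_isRoot_norm_sub_lt (z := z) hε.le (by
        rwa [Matrix.charpoly_natDegree_eq_dim, Fintype.card_fin])
    refine ⟨(r, l), ⟨⟨hl1, hlS⟩, ?_⟩, ?_⟩
    · rw [charFun_eq_eval_charpoly]
      exact hr
    · rw [Prod.dist_eq, max_lt_iff, dist_comm lam]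
      exact ⟨by rwa [dist_eq_norm], hl2⟩
  have hc : Continuous fun q : ℂ × ℂ => ((q.1 : OnePoint ℂ), q.2) :=
    (OnePoint.continuous_coe.comp continuous_fst).prodMk continuous_snd
  refine closure_mono ?_ (image_closure_subset_closure_image hc ⟨_, hT, rfl⟩)
  rintro _ ⟨⟨z', l'⟩, ⟨h1, h2⟩, rfl⟩
  exact ⟨z', l', rfl, h1, h2⟩

/-- The transformation `(z, lam) ↦ (z⁻¹, Nη - lam)` of `ℙ¹ × ℂ`. -/
noncomputable def inversion (N : ℕ) (η : ℂ) (P : OnePoint ℂ × ℂ) : OnePoint ℂ × ℂ :=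
  (RiemannSphere.inv P.1, N * η - P.2)

lemma inversion_inversion (P : OnePoint ℂ × ℂ) : inversion N η (inversion N η P) = P := by
  simp [inversion, RiemannSphere.inv_inv]

lemma continuous_inversion : Continuous (inversion N η) :=
  (RiemannSphere.continuous_inv.comp continuous_fst).prodMk (continuous_const.sub continuous_snd)

lemma mdifferentiable_inversion :
    MDifferentiable (𝓘(ℂ, ℂ).prod 𝓘(ℂ, ℂ)) (𝓘(ℂ, ℂ).prod 𝓘(ℂ, ℂ)) (inversion N η) := by
  have h : MDifferentiable 𝓘(ℂ, ℂ) 𝓘(ℂ, ℂ) fun l : ℂ => N * η - l :=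
    (differentiable_id.const_sub (N * η)).mdifferentiable
  exact (RiemannSphere.mdifferentiable_inv.comp mdifferentiable_fst).prodMk
    (h.comp mdifferentiable_snd)

/-- This is what makes the inversion respect the identification of points and descend to the
quotient. -/
lemma inversion_shift (m₁ m₂ : ℤ) (P : OnePoint ℂ × ℂ) :
    inversion N η (shift L η m₁ m₂ P) = shift L η (-m₁) (-m₂) (inversion N η P) := by
  obtain ⟨w, l⟩ := P
  refine Prod.ext ?_ ?_
  · induction w using OnePoint.rec with
    | infty =>
      change RiemannSphere.inv OnePoint.infty = _
      simp [inversion, shift, RiemannSphere.inv_infty]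
    | coe z =>
      simp only [inversion, shift, OnePoint.map_some]
      rcases eq_or_ne z 0 with rfl | hz
      · rw [mul_zero, RiemannSphere.inv_zero]
        rfl
      · rw [RiemannSphere.inv_coe hz,
          RiemannSphere.inv_coe (mul_ne_zero (Complex.exp_ne_zero _) hz), OnePoint.map_some,
          mul_inv, ← Complex.exp_neg]
        congr 3
        push_cast
        ring
  · simp only [inversion, shift]
    push_cast
    ring

variable {L η x}

lemma charFun_inv_eq_zero (hη : η ∉ L.lattice)
    (hx : ∀ i j, i ≠ j → x i - x j ∉ L.lattice)
    (hxη : ∀ i j, i ≠ j → x i - x j - η ∉ L.lattice)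
    (hturn : IsTurningPoint L η x p) {lam : ℂ} (hl : lam ∉ L.lattice)
    (hm : N * η - lam ∉ L.lattice) {z : ℂ} (hz : charFun L η x p z lam = 0) :
    z ≠ 0 ∧ charFun L η x p z⁻¹ (N * η - lam) = 0 := by
  have hU := diagonal_gaugeDiag_inv hη hx hxη lam
  have hA := laxMatrix_transpose_mul p hη hx hxη hturn hl hm
  rw [charFun, ← Matrix.det_transpose] at hz
  rw [charFun]
  simp only [Matrix.transpose_sub, Matrix.transpose_smul, Matrix.transpose_one] at hz
  set A := (laxMatrix L η x p lam).transpose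
  set B := laxMatrix L η x p (N * η - lam)
  set U := Matrix.diagonal (gaugeDiag L η x lam)
  set V := Matrix.diagonal fun i => (gaugeDiag L η x lam i)⁻¹
  have hdA : A.det ≠ 0 := fun h => by
    have := congrArg Matrix.det hA
    rw [Matrix.det_mul, h, zero_mul, Matrix.det_one] at this
    exact zero_ne_one this
  have hdUV : U.det * V.det = 1 := by rw [← Matrix.det_mul, hU, Matrix.det_one]
  have hz0 : z ≠ 0 := by
    rintro rfl
    rw [zero_smul, zero_sub, Matrix.det_neg] at hz
    exact mul_ne_zero (pow_ne_zero _ (by norm_num)) hdA hz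
  refine ⟨hz0, ?_⟩
  -- Since `A U B V = 1` and `U V = 1`, both sides equal `z⁻¹ A - 1`.
  have h1 : A * (U * (z⁻¹ • (1 : Matrix (Fin N) (Fin N) ℂ) - B) * V) =
      (-z⁻¹) • (z • (1 : Matrix (Fin N) (Fin N) ℂ) - A) := by
    rw [Matrix.mul_sub, Matrix.sub_mul, Matrix.mul_sub, hA, Matrix.mul_smul, Matrix.mul_one,
      Matrix.smul_mul, hU, Matrix.mul_smul, Matrix.mul_one, smul_sub, smul_smul, neg_mul,
      inv_mul_cancel₀ hz0, neg_smul, neg_smul, one_smul]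
    abel
  have h2 := congrArg Matrix.det h1
  rw [Matrix.det_smul, hz, mul_zero, Matrix.det_mul, Matrix.det_mul, Matrix.det_mul] at h2
  have h3 := (mul_eq_zero.mp h2).resolve_left hdA
  linear_combination h3 - (z⁻¹ • (1 : Matrix (Fin N) (Fin N) ℂ) - B).det * hdUV

/-- Parameters with `N * η - lam` in the lattice escape the matrix identity, but they are countable.
The cover is thus the closure of the remaining part, and a continuous map carries closures into
closures. -/
lemma inversion_mem_spectralCover (hη : η ∉ L.lattice)
    (hx : ∀ i j, i ≠ j → x i - x j ∉ L.lattice)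
    (hxη : ∀ i j, i ≠ j → x i - x j - η ∉ L.lattice)
    (hturn : IsTurningPoint L η x p) {P : OnePoint ℂ × ℂ} (hP : P ∈ spectralCover L η x p) :
    inversion N η P ∈ spectralCover L η x p := by
  have hS : Dense {l : ℂ | N * η - l ∈ L.lattice}ᶜ :=
    (L.countable_lattice.preimage (sub_right_injective (b := N * η))).dense_compl ℂ
  refine MapsTo.closure ?_ (continuous_inversion η) (spectralCover_subset_closure L η x p hS hP)
  rintro _ ⟨z, lam, rfl, ⟨hl, hm⟩, hz⟩
  obtain ⟨hz0, hz'⟩ := charFun_inv_eq_zero p hη hx hxη hturn hl hm hz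
  exact ⟨z⁻¹, N * η - lam, by simp only [inversion, RiemannSphere.inv_coe hz0], hm, hz'⟩

end RuijsenaarsSchneider

theorem theorem3 {N : ℕ} (L : PeriodPair) (η : ℂ) (x p : Fin N → ℂ)
    (hη : η ∉ L.lattice)
    (hx : ∀ i j, i ≠ j → x i - x j ∉ L.lattice)
    (hxη : ∀ i j, i ≠ j → x i - x j - η ∉ L.lattice)
    (hturn : RuijsenaarsSchneider.IsTurningPoint L η x p) :
    (∃ ι : RuijsenaarsSchneider.SpectralCurve L η x p →
          RuijsenaarsSchneider.SpectralCurve L η x p,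
        RuijsenaarsSchneider.SpectralCurve.IsHolomorphic ι ∧
        Function.Involutive ι ∧
        ∀ (z : OnePoint ℂ) (lam : ℂ)
          (h : (z, lam) ∈ RuijsenaarsSchneider.spectralCover L η x p),
          ∃ h' : (RiemannSphere.inv z, N * η - lam) ∈
              RuijsenaarsSchneider.spectralCover L η x p,
            ι (RuijsenaarsSchneider.SpectralCurve.mk (z, lam) h) =
              RuijsenaarsSchneider.SpectralCurve.mk
                (RiemannSphere.inv z, N * η - lam) h') ∧
    ∀ lam : ℂ, lam ∉ L.lattice → N * η - lam ∉ L.lattice →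
      IsUnit (RuijsenaarsSchneider.laxMatrix L η x p lam) ∧
      IsUnit (Matrix.diagonal (RuijsenaarsSchneider.gaugeDiag L η x lam)) ∧
      ((RuijsenaarsSchneider.laxMatrix L η x p lam).transpose)⁻¹ =
        Matrix.diagonal (RuijsenaarsSchneider.gaugeDiag L η x lam) *
          RuijsenaarsSchneider.laxMatrix L η x p (N * η - lam) *
          (Matrix.diagonal (RuijsenaarsSchneider.gaugeDiag L η x lam))⁻¹ := by
  have hmem := fun (P : OnePoint ℂ × ℂ) (hP : P ∈ RuijsenaarsSchneider.spectralCover L η x p) =>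
    RuijsenaarsSchneider.inversion_mem_spectralCover p hη hx hxη hturn hP
  -- A single map, the inversion of the whole surface `ℙ¹ × ℂ`, serves as the local holomorphic lift
  -- at every point.
  refine ⟨⟨Quotient.map' (fun P => ⟨RuijsenaarsSchneider.inversion N η P.1, hmem P.1 P.2⟩) ?_,
    fun P _ => ⟨RuijsenaarsSchneider.inversion N η,
      .of_forall (RuijsenaarsSchneider.mdifferentiable_inversion η),
      .of_forall fun Q hQ => ⟨hmem Q hQ, rfl⟩⟩, ?_, fun z lam h => ⟨hmem _ h, rfl⟩⟩,
    fun lam hl hm => RuijsenaarsSchneider.laxMatrix_transpose_inv p hη hx hxη hturn hl hm⟩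
  · rintro P Q ⟨m₁, m₂, h⟩
    refine ⟨-m₁, -m₂, ?_⟩
    change RuijsenaarsSchneider.inversion N η Q.1 = _
    rw [h, RuijsenaarsSchneider.inversion_shift]
  · intro γ
    induction γ using Quotient.inductionOn' with
    | h P =>
      exact congrArg (Quotient.mk _)
        (Subtype.ext (RuijsenaarsSchneider.inversion_inversion η P.1))
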